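/- \textbf{Setting.} Let $G$ be a locally compact, $\sigma$-compact (Hausdorff) abelian group, written additively, with a fixed Haar measure $A\mapsto |A|$, $\int\cdot\,\mathrm{d}t$; let $\widehat G$ be the set of continuous group homomorphisms $\xi:G\to\mathbb{T}=\{z\in\mathbb{C}:|z|=1\}$. Let $X$ be a compact metric space with a continuous action $(t,x)\mapsto tx$ of $G$, and let $m$ be a $G$-invariant Borel probability measure on $X$. Let $(B_n)$ be a F\o lner sequence in $G$, i.e. a sequence of non-empty open relatively compact sets with $|B_n\,\triangle\,(t+B_n)|/|B_n|\to 0$ for every $t\in G$. \textbf{Definitions.} $(X,G,m)$ is \emph{ergodic} if every $G$-invariant measurable subset of $X$ has measure $0$ or $1$. \emph{Birkhoff's ergodic theorem holds along} $(B_n)$ if for every $m$-integrable $f:X\to\mathbb{C}$ one has $\lim_n \frac{1}{|B_n|}\int_{B_n} f(tx)\,\mathrm{d}t=\int_X f\,\mathrm{d}m$ for $m$-almost every $x\in X$. An \emph{eigenfunction} is an $f\in L^2(X,m)$, $f\ne 0$, such that for each $t\in G$ there is $\xi(t)\in\mathbb{C}$ with $f(t\,\cdot)=\xi(t)f$ in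 $L^2(X,m)$; then $\xi\in\widehat G$, and $\xi$ is called an \emph{eigenvalue}. $\mathrm{Eig}(X,G,m)\subset\widehat G$ is the set of eigenvalues, and $(X,G,m)$ has \emph{pure point spectrum} if $L^2(X,m)$ has an orthonormal basis consisting of eigenfunctions. For $\xi\in\widehat G$, $P_\xi$ is the orthogonal projection of $L^2(X,m)$ onto the eigenspace of $\xi$ ($P_\xi=0$ if $\xi$ is not an eigenvalue). For bounded measurable $h:G\to\mathbb{C}$ put $\mathrm{A}(h):=\lim_n\frac{1}{|B_n|}\int_{B_n}h(t)\,\mathrm{d}t$ whenever the limit exists, and for bounded measurable real-valued $h$ put $\overline{M}(h):=\limsup_n\frac1{|B_n|}\int_{B_n}h(t)\,\mathrm{d}t$. A bounded measurable $h:G\to\mathbb{C}$ is \emph{Besicovitch almost periodic} if for every $\varepsilon>0$ there are $k\in\mathbb{N}$, $\xi_1,\dots,\xi_k\in\widehat G$ and $c_1,\dots,c_k\in\mathbb{C}$ with $\overline{M}\big(|h-\sum_{j=1}^k c_j\xi_j|\big)<\varepsilon$. For $f\in C(X)$ (continuous complex-valued functions) and $x\in X$ let $f_x:G\to\mathbb{C}$,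 $f_x(t)=f(tx)$. A point $x\in X$ is \emph{Besicovitch almost periodic} if $f_x$ is Besicovitch almost periodic for every $f\in C(X)$, and it is \emph{$m$-generic} if $\mathrm{A}(f_x)$ exists and equals $\int_X f\,\mathrm{d}m$ for every $f\in C(X)$. $\mathrm{Bap}(X,G,m)$ is the set of $m$-generic Besicovitch almost periodic points. For such a point $x$, $\mathrm{Freq}(x)$ is the set of $\xi\in\widehat G$ with $\mathrm{A}(f_x\overline{\xi})\neq0$ for some $f\in C(X)$. \textbf{Theorem.} Let $(X,G,m)$ be ergodic and let $(B_n)$ be a F\o lner sequence along which Birkhoff's ergodic theorem holds. Then the following assertions are equivalent: \begin{itemize} \item[(i)] $(X,G,m)$ has pure point spectrum. \item[(ii)] $\mathrm{Bap}(X,G,m)$ is $m$-measurable and $m(\mathrm{Bap}(X,G,m))=1$. \item[(iii)] $\mathrm{Bap}(X,G,m)\neq\varnothing$. \end{itemize} If one of these equivalent conditions holds, then $\mathrm{Eig}(X,G,m)=\mathrm{Freq}(x)$ for every $x\in\mathrm{Bap}(X,G,m)$. Moreover, in this case, for every $f\in C(X)$ and every $\xi\in\widehat G$ the limit $\mathrm{A}(f_x\overline\xi)$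 exists for all $x\in\mathrm{Bap}(X,G,m)$, and the function $$e_{f,\xi}:X\to\mathbb{C},\qquad e_{f,\xi}(x):=\begin{cases}\mathrm{A}(f_x\overline{\xi}) & x\in\mathrm{Bap}(X,G,m),\\ 0&\text{otherwise,}\end{cases}$$ satisfies $P_\xi f=e_{f,\xi}$ in $L^2(X,m)$, satisfies $e_{f,\xi}(tx)=\xi(t)\,e_{f,\xi}(x)$ for all $t\in G$ and all $x\in X$, and has constant modulus on $\mathrm{Bap}(X,G,m)$. -/

import Mathlib

open MeasureTheory Filter Topology

/-- A Følner sequence of the kind used for averaging along orbits: nonempty open relatively compact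
sets with `|(t + B n) ∆ B n| / |B n| → 0` for every `t` (the last part is `IsAddFoelner`). -/
structure IsOpenFolnerSeq {G : Type*} [TopologicalSpace G] [AddGroup G] [MeasurableSpace G]
    (μ : Measure G) (B : ℕ → Set G) : Prop where
  isOpen : ∀ n, IsOpen (B n)
  nonempty : ∀ n, (B n).Nonempty
  isCompact_closure : ∀ n, IsCompact (closure (B n))
  isAddFoelner : IsAddFoelner G μ atTop B

/-- The dual group as a type: continuous group homomorphisms from the additive group `G` to the
unit circle. -/
abbrev DualChar (G : Type*) [AddGroup G] [TopologicalSpace G] : Type _ :=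
  {ξ : AddChar G Circle // Continuous ξ}

section Averages

variable {G : Type*} [AddGroup G] [TopologicalSpace G] [MeasurableSpace G]

/-- The upper mean `limsup (1 / |B n|) ∫_{B n} h` of a (bounded measurable) real function. -/
noncomputable def upperMean (μ : Measure G) (B : ℕ → Set G) (h : G → ℝ) : ℝ :=
  limsup (fun n => ⨍ s in B n, h s ∂μ) atTop

/-- `h` has the mean `a` along `B`: the averages `(1 / |B n|) ∫_{B n} h` converge to `a`. -/
def HasMean (μ : Measure G) (B : ℕ → Set G) (h : G → ℂ) (a : ℂ) : Prop :=
  Tendsto (fun n => ⨍ s in B n, h s ∂μ) atTop (𝓝 a)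

/-- The mean `A(h)`; meaningful if the averages converge, that is if `HasMean μ B h a` holds for
some `a` (and then `mean μ B h = a`). -/
noncomputable def mean (μ : Measure G) (B : ℕ → Set G) (h : G → ℂ) : ℂ :=
  limUnder atTop (fun n => ⨍ s in B n, h s ∂μ)

/-- Besicovitch almost periodic functions: bounded measurable functions that are approximated by
trigonometric polynomials with respect to the upper mean. -/
def IsBesicovitchAPFun (μ : Measure G) (B : ℕ → Set G) (f : G → ℂ) : Prop :=
  Measurable f ∧ (∃ C : ℝ, ∀ t, ‖f t‖ ≤ C) ∧
    ∀ ε : ℝ, 0 < ε → ∃ (k : ℕ) (ξ : Fin k → DualChar G) (c : Fin k → ℂ),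
      upperMean μ B (fun s => ‖f s - ∑ j, c j * ((ξ j).1 s : ℂ)‖) < ε

end Averages

section Points

variable {G X : Type*} [AddGroup G] [TopologicalSpace G] [MeasurableSpace G]
  [TopologicalSpace X] [AddAction G X]

/-- The function `f_x : t ↦ f (t x)` on the group. -/
def orbitFun (f : X → ℂ) (x : X) : G → ℂ := fun t => f (t +ᵥ x)

/-- Besicovitch almost periodic points: all functions `f_x`, `f ∈ C(X)`, are Besicovitch almost
periodic. -/
def IsBesicovitchAPPoint (μ : Measure G) (B : ℕ → Set G) (x : X) : Prop :=
  ∀ f : C(X, ℂ), IsBesicovitchAPFun μ B (orbitFun f x)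

/-- The point `x` is `m`-generic along `B`. -/
def IsMeasureGenericPoint [MeasurableSpace X] (μ : Measure G) (B : ℕ → Set G) (m : Measure X)
    (x : X) : Prop :=
  ∀ f : C(X, ℂ), HasMean μ B (orbitFun f x) (∫ y, f y ∂m)

/-- `Bap(X,G,m)`: the Besicovitch almost periodic points that are generic for `m`. -/
def Bap [MeasurableSpace X] (μ : Measure G) (B : ℕ → Set G) (m : Measure X) : Set X :=
  {x | IsBesicovitchAPPoint μ B x ∧ IsMeasureGenericPoint μ B m x}

/-- The function `f_x · conj ξ` on the group. -/
noncomputable def twistedOrbitFun (f : X → ℂ) (ξ : DualChar G) (x : X) : G → ℂ :=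
  fun t => orbitFun f x t * (starRingEnd ℂ) (ξ.1 t : ℂ)

/-- The frequencies of a point `x`: the characters `ξ` with `A(f_x · conj ξ) ≠ 0` for some
`f ∈ C(X)`. -/
def Freq (μ : Measure G) (B : ℕ → Set G) (x : X) : Set (DualChar G) :=
  {ξ | ∃ (f : C(X, ℂ)) (a : ℂ), HasMean μ B (twistedOrbitFun f ξ x) a ∧ a ≠ 0}

/-- The function `e_{f,ξ}`: it is `A(f_x · conj ξ)` for `x` in `Bap(X,G,m)` and `0` elsewhere. -/
noncomputable def eFun [MeasurableSpace X] (μ : Measure G) (B : ℕ → Set G) (m : Measure X)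
    (f : C(X, ℂ)) (ξ : DualChar G) : X → ℂ :=
  (Bap μ B m).indicator (fun x => mean μ B (twistedOrbitFun f ξ x))

end Points

section Ergodic

variable {X : Type*} [MeasurableSpace X]

/-- Ergodicity: every measurable set that is invariant under the group has measure `0` or `1`. -/
def IsErgodicSystem (G : Type*) [AddGroup G] [AddAction G X] (m : Measure X) : Prop :=
  ∀ A : Set X, MeasurableSet A → (∀ t : G, (fun x => t +ᵥ x) ⁻¹' A = A) → m A = 0 ∨ m A = 1

/-- Birkhoff's ergodic theorem holds along `B`: for every integrable `f` the averages of `f` along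
the orbit of almost every point converge to the integral of `f`. -/
def BirkhoffHolds {G : Type*} [AddGroup G] [TopologicalSpace G] [MeasurableSpace G]
    [AddAction G X] (μ : Measure G) (B : ℕ → Set G) (m : Measure X) : Prop :=
  ∀ f : X → ℂ, Integrable f m → ∀ᵐ x ∂m, HasMean μ B (orbitFun f x) (∫ y, f y ∂m)

end Ergodic

section Spectrum

variable {G X : Type*} [AddGroup G] [MeasurableSpace X] [AddAction G X] [MeasurableConstVAdd G X]

/-- The isometry `φ ↦ φ(t ·)` of `L²(X,m)`. -/
noncomputable def koopman (m : Measure X) [VAddInvariantMeasure G X m] (t : G) :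
    Lp ℂ 2 m →ₗᵢ[ℂ] Lp ℂ 2 m :=
  Lp.compMeasurePreservingₗᵢ ℂ (fun x : X => t +ᵥ x) (measurePreserving_vadd t m)

/-- Eigenfunctions: nonzero `φ ∈ L²(X,m)` such that each `φ(t ·)` is a multiple of `φ`. -/
def IsEigenfunction (G : Type*) [AddGroup G] [AddAction G X] [MeasurableConstVAdd G X]
    (m : Measure X) [VAddInvariantMeasure G X m] (φ : Lp ℂ 2 m) : Prop :=
  φ ≠ 0 ∧ ∀ t : G, ∃ c : ℂ, koopman m t φ = c • φ

/-- Pure point spectrum: there is an orthonormal basis of `L²(X,m)` that consists of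
eigenfunctions. -/
def HasPurePointSpectrum (G : Type*) [AddGroup G] [AddAction G X] [MeasurableConstVAdd G X]
    (m : Measure X) [VAddInvariantMeasure G X m] : Prop :=
  ∃ (S : Set (Lp ℂ 2 m)) (b : HilbertBasis S ℂ (Lp ℂ 2 m)),
    (⇑b = fun φ : S => (φ : Lp ℂ 2 m)) ∧ ∀ φ ∈ S, IsEigenfunction G m φ

variable [TopologicalSpace G]

/-- The eigenspace of `ξ`: all `φ ∈ L²(X,m)` with `φ(t ·) = ξ(t) φ` for all `t`. -/
noncomputable def eigenspace (m : Measure X) [VAddInvariantMeasure G X m] (ξ : DualChar G) :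
    Submodule ℂ (Lp ℂ 2 m) :=
  ⨅ t : G, LinearMap.ker ((koopman m t).toLinearMap - (ξ.1 t : ℂ) • LinearMap.id)

theorem mem_eigenspace_iff (m : Measure X) [VAddInvariantMeasure G X m] (ξ : DualChar G)
    (φ : Lp ℂ 2 m) :
    φ ∈ eigenspace m ξ ↔ ∀ t : G, koopman m t φ = (ξ.1 t : ℂ) • φ := by
  simp [eigenspace, sub_eq_zero]

theorem isClosed_eigenspace (m : Measure X) [VAddInvariantMeasure G X m] (ξ : DualChar G) :
    IsClosed (eigenspace m ξ : Set (Lp ℂ 2 m)) := by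
  have h : (eigenspace m ξ : Set (Lp ℂ 2 m)) =
      ⋂ t : G, {φ | koopman m t φ = (ξ.1 t : ℂ) • φ} := by
    ext φ
    simp [mem_eigenspace_iff]
  rw [h]
  exact isClosed_iInter fun t =>
    isClosed_eq (koopman m t).continuous (continuous_const_smul _)

instance completeSpace_eigenspace (m : Measure X) [VAddInvariantMeasure G X m]
    (ξ : DualChar G) : CompleteSpace (eigenspace m ξ) :=
  (isClosed_eigenspace m ξ).completeSpace_coe

/-- The set of eigenvalues: the characters that have an eigenfunction. -/
def Eig (m : Measure X) [VAddInvariantMeasure G X m] : Set (DualChar G) :=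
  {ξ | ∃ φ : Lp ℂ 2 m, φ ≠ 0 ∧ ∀ t : G, koopman m t φ = (ξ.1 t : ℂ) • φ}

/-- The orthogonal projection `P_ξ` onto the eigenspace of `ξ`. If `ξ` is not an eigenvalue, the
eigenspace is `0` and so is the projection. -/
noncomputable def eigenProj (m : Measure X) [VAddInvariantMeasure G X m] (ξ : DualChar G) :
    Lp ℂ 2 m →L[ℂ] Lp ℂ 2 m :=
  (eigenspace m ξ).starProjection

end Spectrum

/-! The bridge between orbits and spectrum is genericity: at a point x of `Bap` the orbit mean of
|f_x|² is ‖f‖² in L²(X,m), so Fourier–Bohr analysis of f_x becomes Hilbert space geometry of f.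

From one point to the spectrum: fix x in `Bap`. Bessel's inequality for means bounds f ↦ A(f_x conj
ξ) by the L² norm, so it equals ⟪ψ_ξ, f⟫ for some ψ_ξ with ‖ψ_ξ‖ ≤ 1, and Følner invariance puts ψ_ξ
into the eigenspace of ξ (`exists_eigenvector_of_mem_Bap`). Approximation of f_x in quadratic mean
(`IsBesicovitchAPFun.exists_quadratic_approx`) gives Parseval's identity ∑ |⟪ψ_ξ, f⟫|² = ‖f‖². With
the orthogonality of distinct eigenspaces this forces each ψ_ξ to be zero or a unit vector, and the
family to be total (`exists_eigenvectors_of_mem_Bap`). Hence the spectrum is pure point, and the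
eigenvalues are the ξ with ψ_ξ ≠ 0, which are the frequencies of x.

From the spectrum to almost every point: approximate f in L² by a combination g of eigenfunctions.
By Fubini, g is a trigonometric polynomial along almost every orbit, up to a null set of times, and
Birkhoff's theorem for |f - g| bounds the mean error. A countable dense set of f suffices
(`mem_Bap_of_dense`).

Birkhoff's theorem also makes invariant functions constant, so eigenspaces are at most
one-dimensional. Therefore |e_{f,ξ}(x)| = |⟪ψ_ξ, P_ξ f⟫| = ‖P_ξ f‖ on `Bap`, and Birkhoff's theorem
for f · conj (P_ξ f) identifies e_{f,ξ} with P_ξ f. -/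

set_option linter.unusedSectionVars false

open scoped Pointwise InnerProductSpace

/-! ### Bounded measurable functions and averages -/

section BddMeas

variable {G E : Type*} [MeasurableSpace G] [NormedAddCommGroup E] [MeasurableSpace E]

/-- Bounded measurable functions. -/
def IsBddMeas (h : G → E) : Prop :=
  Measurable h ∧ ∃ C : ℝ, ∀ t, ‖h t‖ ≤ C

variable [BorelSpace E] [SecondCountableTopology E]

theorem IsBddMeas.const (c : E) : IsBddMeas (fun _ : G => c) :=
  ⟨measurable_const, ‖c‖, fun _ => le_rfl⟩

theorem IsBddMeas.add {h k : G → E} (hh : IsBddMeas h) (hk : IsBddMeas k) :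
    IsBddMeas (fun t => h t + k t) := by
  obtain ⟨h1, C, hC⟩ := hh
  obtain ⟨k1, D, hD⟩ := hk
  exact ⟨h1.add k1, C + D, fun t => (norm_add_le _ _).trans (add_le_add (hC t) (hD t))⟩

theorem IsBddMeas.sub {h k : G → E} (hh : IsBddMeas h) (hk : IsBddMeas k) :
    IsBddMeas (fun t => h t - k t) := by
  obtain ⟨h1, C, hC⟩ := hh
  obtain ⟨k1, D, hD⟩ := hk
  exact ⟨h1.sub k1, C + D, fun t => (norm_sub_le _ _).trans (add_le_add (hC t) (hD t))⟩

theorem IsBddMeas.norm {h : G → E} (hh : IsBddMeas h) : IsBddMeas (fun t => ‖h t‖) := by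
  obtain ⟨h1, C, hC⟩ := hh
  exact ⟨h1.norm, C, fun t => by simpa using hC t⟩

theorem IsBddMeas.comp {G' : Type*} [MeasurableSpace G'] {h : G → E} (hh : IsBddMeas h)
    {u : G' → G} (hu : Measurable u) : IsBddMeas (fun t => h (u t)) :=
  ⟨hh.1.comp hu, hh.2.imp fun _ hC t => hC (u t)⟩

theorem IsBddMeas.mul {h k : G → ℂ} (hh : IsBddMeas h) (hk : IsBddMeas k) :
    IsBddMeas (fun t => h t * k t) := by
  obtain ⟨h1, C, hC⟩ := hh
  obtain ⟨k1, D, hD⟩ := hk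
  refine ⟨h1.mul k1, C * D, fun t => ?_⟩
  rw [norm_mul]
  exact mul_le_mul (hC t) (hD t) (norm_nonneg _) ((norm_nonneg _).trans (hC t))

theorem IsBddMeas.conj {h : G → ℂ} (hh : IsBddMeas h) :
    IsBddMeas (fun t => (starRingEnd ℂ) (h t)) := by
  obtain ⟨h1, C, hC⟩ := hh
  exact ⟨Complex.continuous_conj.measurable.comp h1, C, fun t => by simpa using hC t⟩

theorem IsBddMeas.sq_norm {h : G → ℂ} (hh : IsBddMeas h) : IsBddMeas (fun t => ‖h t‖ ^ 2) := by
  obtain ⟨h1, C, hC⟩ := hh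
  exact ⟨h1.norm.pow_const 2, C ^ 2, fun t => by
    rw [Real.norm_of_nonneg (by positivity)]
    exact pow_le_pow_left₀ (norm_nonneg _) (hC t) 2⟩

theorem IsBddMeas.sum {ι : Type*} (F : Finset ι) {h : ι → G → E} (hh : ∀ i, IsBddMeas (h i)) :
    IsBddMeas (fun t => ∑ i ∈ F, h i t) := by
  classical
  induction F using Finset.induction_on with
  | empty => simpa using IsBddMeas.const (0 : E)
  | insert a s ha ih => simpa [Finset.sum_insert ha] using (hh a).add ih

theorem IsBddMeas.integrable {h : G → E} (hh : IsBddMeas h) (ν : Measure G) [IsFiniteMeasure ν] :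
    Integrable h ν := by
  obtain ⟨h1, C, hC⟩ := hh
  exact Integrable.of_bound h1.aestronglyMeasurable C (ae_of_all _ hC)

end BddMeas

section Averages

variable {G : Type*} [AddCommGroup G] [TopologicalSpace G] [IsTopologicalAddGroup G]
  [MeasurableSpace G] [BorelSpace G]

/-- The normalized restriction of `μ` to `B n`. -/
noncomputable def avgMeasure (μ : Measure G) (B : ℕ → Set G) (n : ℕ) : Measure G :=
  ((μ.restrict (B n)) Set.univ)⁻¹ • μ.restrict (B n)

theorem setAverage_eq_integral_avgMeasure {E : Type*} [NormedAddCommGroup E] [NormedSpace ℝ E]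
    (μ : Measure G) (B : ℕ → Set G) (n : ℕ) (h : G → E) :
    ⨍ s in B n, h s ∂μ = ∫ s, h s ∂(avgMeasure μ B n) := rfl

variable {μ : Measure G} [μ.IsAddHaarMeasure] {B : ℕ → Set G}

theorem IsOpenFolnerSeq.measure_ne_zero (hB : IsOpenFolnerSeq μ B) (n : ℕ) : μ (B n) ≠ 0 :=
  ((hB.isOpen n).measure_pos μ (hB.nonempty n)).ne'

theorem IsOpenFolnerSeq.measure_ne_top (hB : IsOpenFolnerSeq μ B) (n : ℕ) : μ (B n) ≠ ⊤ :=
  ((measure_mono subset_closure).trans_lt (hB.isCompact_closure n).measure_lt_top).ne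

theorem IsOpenFolnerSeq.isProbabilityMeasure (hB : IsOpenFolnerSeq μ B) (n : ℕ) :
    IsProbabilityMeasure (avgMeasure μ B n) := by
  have h1 : IsFiniteMeasure (μ.restrict (B n)) :=
    ⟨by simpa using (hB.measure_ne_top n).lt_top⟩
  have h2 : NeZero (μ.restrict (B n)) := ⟨by simpa using hB.measure_ne_zero n⟩
  exact isProbabilityMeasureSMul

/-- Averages ignore null sets of times. This matters because elements of L² obey their eigenvalue
equation along an orbit only for almost every time. -/
theorem ae_avgMeasure {p : G → Prop} (h : ∀ᵐ t ∂μ, p t) (n : ℕ) :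
    ∀ᵐ t ∂(avgMeasure μ B n), p t :=
  (Measure.smul_absolutelyContinuous.trans Measure.restrict_le_self.absolutelyContinuous) h

/-- After the substitution s ↦ s + t the two integrals differ only on the symmetric difference of t
+ B n and B n, where the integrand is at most C; the Følner condition makes its relative measure
vanish. -/
theorem tendsto_setAverage_translate (hB : IsOpenFolnerSeq μ B) {E : Type*} [NormedAddCommGroup E]
    [NormedSpace ℝ E] [MeasurableSpace E] [BorelSpace E] [SecondCountableTopology E]
    {h : G → E} (hh : IsBddMeas h) (t : G) :
    Tendsto (fun n => ⨍ s in B n, h (s + t) ∂μ - ⨍ s in B n, h s ∂μ) atTop (𝓝 0) := by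
  obtain ⟨C, hC⟩ := hh.2
  have hC0 : 0 ≤ C := (norm_nonneg _).trans (hC 0)
  have hlim : Tendsto (fun n => C * (μ (symmDiff (t +ᵥ B n) (B n)) / μ (B n)).toReal) atTop
      (𝓝 0) := by
    have := (ENNReal.tendsto_toReal ENNReal.zero_ne_top).comp
      (hB.isAddFoelner.tendsto_meas_vadd_symmDiff t)
    simpa using this.const_mul C
  refine squeeze_zero_norm (fun n => ?_) hlim
  have hmB : MeasurableSet (B n) := (hB.isOpen n).measurableSet
  have hmS : MeasurableSet (t +ᵥ B n) := ((hB.isOpen n).vadd t).measurableSet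
  have hS : μ (t +ᵥ B n) = μ (B n) := measure_vadd μ t (B n)
  have hfB := hB.measure_ne_top n
  have hshift : ∫ s in B n, h (s + t) ∂μ = ∫ s in t +ᵥ B n, h s ∂μ := by
    have h2 := (measurePreserving_add_right μ t).setIntegral_preimage_emb
      (measurableEmbedding_addRight t) h (t +ᵥ B n)
    rw [← h2]
    congr 2
    ext s
    simp [Set.mem_vadd_set_iff_neg_vadd_mem, add_comm]
  have hi : ∀ A : Set G, μ A ≠ ⊤ → IntegrableOn h A μ := fun A hA =>
    haveI : IsFiniteMeasure (μ.restrict A) := ⟨by simpa using hA.lt_top⟩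
    hh.integrable _
  have hdiff : ‖∫ s in t +ᵥ B n, h s ∂μ - ∫ s in B n, h s ∂μ‖ ≤
      C * (μ (symmDiff (t +ᵥ B n) (B n))).toReal := by
    rw [← integral_indicator hmS, ← integral_indicator hmB, ← integral_sub
      ((integrable_indicator_iff hmS).2 (hi _ (hS ▸ hfB)))
      ((integrable_indicator_iff hmB).2 (hi _ hfB))]
    have hfin : μ (symmDiff (t +ᵥ B n) (B n)) ≠ ⊤ :=
      ((measure_mono (by
        rw [Set.symmDiff_def]
        exact Set.union_subset_union Set.sdiff_subset Set.sdiff_subset)).trans_lt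
        (measure_union_lt_top (hS ▸ hfB.lt_top) hfB.lt_top)).ne
    have hms := hmS.symmDiff hmB
    have hb : Integrable ((symmDiff (t +ᵥ B n) (B n)).indicator fun _ => C) μ :=
      (integrable_indicator_iff hms).2 (integrableOn_const hfin)
    refine (norm_integral_le_of_norm_le hb (ae_of_all _ fun s => ?_)).trans ?_
    · by_cases h1 : s ∈ t +ᵥ B n <;> by_cases h2 : s ∈ B n <;>
        simp [Set.indicator, Set.mem_symmDiff, h1, h2, hC s]
    · rw [integral_indicator hms]
      simp [Measure.real, mul_comm]
  rw [setAverage_eq, setAverage_eq, ← smul_sub, norm_smul, hshift, ENNReal.toReal_div]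
  have hp : 0 < (μ (B n)).toReal := ENNReal.toReal_pos (hB.measure_ne_zero n) hfB
  rw [Real.norm_of_nonneg (by positivity)]
  calc (μ.real (B n))⁻¹ * _ ≤ (μ.real (B n))⁻¹ * (C * (μ (symmDiff (t +ᵥ B n) (B n))).toReal) := by
        gcongr
    _ = _ := by rw [Measure.real]; field_simp

end Averages

section Means

variable {G : Type*} [AddCommGroup G] [TopologicalSpace G] [IsTopologicalAddGroup G]
  [MeasurableSpace G] [BorelSpace G] {μ : Measure G} [μ.IsAddHaarMeasure] {B : ℕ → Set G}

theorem HasMean.unique {h : G → ℂ} {a b : ℂ} (ha : HasMean μ B h a) (hb : HasMean μ B h b) :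
    a = b := tendsto_nhds_unique ha hb

theorem HasMean.congr_ae {h k : G → ℂ} {a : ℂ} (ha : HasMean μ B h a) (hk : ∀ᵐ t ∂μ, h t = k t) :
    HasMean μ B k a := by
  refine Tendsto.congr (fun n => ?_) ha
  exact integral_congr_ae (ae_avgMeasure hk n)

theorem HasMean.const (hB : IsOpenFolnerSeq μ B) (c : ℂ) : HasMean μ B (fun _ => c) c := by
  have h : ∀ n, ⨍ _ in B n, c ∂μ = c := fun n => by
    have := hB.isProbabilityMeasure n
    rw [setAverage_eq_integral_avgMeasure, integral_const]
    simp
  simp only [HasMean, h]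
  exact tendsto_const_nhds

theorem HasMean.add {h k : G → ℂ} {a b : ℂ} (ha : HasMean μ B h a)
    (hb : HasMean μ B k b) (hh : IsBddMeas h) (hk : IsBddMeas k) :
    HasMean μ B (fun t => h t + k t) (a + b) := by
  refine (Tendsto.add ha hb).congr fun n => ?_
  exact (integral_add (hh.integrable _) (hk.integrable _)).symm

theorem HasMean.sub {h k : G → ℂ} {a b : ℂ} (ha : HasMean μ B h a)
    (hb : HasMean μ B k b) (hh : IsBddMeas h) (hk : IsBddMeas k) :
    HasMean μ B (fun t => h t - k t) (a - b) := by
  refine (Tendsto.sub ha hb).congr fun n => ?_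
  exact (integral_sub (hh.integrable _) (hk.integrable _)).symm

theorem HasMean.const_mul {h : G → ℂ} {a : ℂ} (c : ℂ) (ha : HasMean μ B h a) :
    HasMean μ B (fun t => c * h t) (c * a) := by
  refine (Tendsto.const_mul c ha).congr fun n => ?_
  exact (integral_const_mul c h).symm

theorem HasMean.conj {h : G → ℂ} {a : ℂ} (ha : HasMean μ B h a) :
    HasMean μ B (fun t => (starRingEnd ℂ) (h t)) ((starRingEnd ℂ) a) := by
  refine ((Complex.continuous_conj.tendsto a).comp ha).congr fun n => ?_
  exact integral_conj.symm

theorem HasMean.sum (hB : IsOpenFolnerSeq μ B) {ι : Type*} (F : Finset ι) {h : ι → G → ℂ}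
    {a : ι → ℂ} (ha : ∀ i, HasMean μ B (h i) (a i)) (hh : ∀ i, IsBddMeas (h i)) :
    HasMean μ B (fun t => ∑ i ∈ F, h i t) (∑ i ∈ F, a i) := by
  classical
  induction F using Finset.induction_on with
  | empty => simpa using HasMean.const hB 0
  | insert i s hi ih =>
    simpa [Finset.sum_insert hi] using (ha i).add ih (hh i) (IsBddMeas.sum s hh)

theorem HasMean.translate (hB : IsOpenFolnerSeq μ B) {h : G → ℂ} {a : ℂ} (ha : HasMean μ B h a)
    (hh : IsBddMeas h) (t : G) : HasMean μ B (fun s => h (s + t)) a := by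
  have := (tendsto_setAverage_translate hB hh t).add ha
  simpa [HasMean] using this

theorem norm_setAverage_sub_le (hB : IsOpenFolnerSeq μ B) {h k : G → ℂ} (hh : IsBddMeas h)
    (hk : IsBddMeas k) (n : ℕ) :
    ‖⨍ s in B n, h s ∂μ - ⨍ s in B n, k s ∂μ‖ ≤ ⨍ s in B n, ‖h s - k s‖ ∂μ := by
  have := hB.isProbabilityMeasure n
  simp only [setAverage_eq_integral_avgMeasure]
  rw [← integral_sub (hh.integrable _) (hk.integrable _)]
  exact norm_integral_le_integral_norm _

theorem setAverage_mono {h k : G → ℝ} (hh : IsBddMeas h)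
    (hk : IsBddMeas k) (hle : ∀ t, h t ≤ k t) (n : ℕ) :
    ⨍ s in B n, h s ∂μ ≤ ⨍ s in B n, k s ∂μ := by
  exact integral_mono (hh.integrable _) (hk.integrable _) hle

theorem setAverage_add {h k : G → ℝ} (hh : IsBddMeas h)
    (hk : IsBddMeas k) (n : ℕ) :
    ⨍ s in B n, (h s + k s) ∂μ = ⨍ s in B n, h s ∂μ + ⨍ s in B n, k s ∂μ := by
  exact integral_add (hh.integrable _) (hk.integrable _)

theorem setAverage_const_mul (c : ℝ) (h : G → ℝ) (n : ℕ) :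
    ⨍ s in B n, c * h s ∂μ = c * ⨍ s in B n, h s ∂μ :=
  integral_const_mul c h

theorem setAverage_le_const (hB : IsOpenFolnerSeq μ B) {h : G → ℝ} (hh : IsBddMeas h) {C : ℝ}
    (hle : ∀ t, h t ≤ C) (n : ℕ) : ⨍ s in B n, h s ∂μ ≤ C := by
  have := hB.isProbabilityMeasure n
  refine (setAverage_mono hh (IsBddMeas.const C) hle n).trans_eq ?_
  rw [setAverage_eq_integral_avgMeasure, integral_const]
  simp

/-- A function that is approximated in mean by functions whose means exist has a mean, and its mean
is the limit of the approximating means. -/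
theorem hasMean_of_approx (hB : IsOpenFolnerSeq μ B) {h : G → ℂ} (hh : IsBddMeas h) {a : ℂ}
    (H : ∀ ε > 0, ∃ (g : G → ℂ) (b : ℂ), IsBddMeas g ∧ HasMean μ B g b ∧ ‖a - b‖ ≤ ε ∧
      ∀ᶠ n in atTop, ⨍ s in B n, ‖h s - g s‖ ∂μ ≤ ε) : HasMean μ B h a := by
  rw [HasMean, Metric.tendsto_atTop']
  intro ε hε
  obtain ⟨g, b, hg, hgb, hab, hev⟩ := H (ε / 4) (by positivity)
  have h2 := Metric.tendsto_nhds.1 hgb (ε / 4) (by positivity)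
  obtain ⟨N, hN⟩ := eventually_atTop.1 (hev.and h2)
  refine ⟨N, fun n hn => ?_⟩
  obtain ⟨h3, h4⟩ := hN n hn.le
  have h5 := norm_setAverage_sub_le hB hh hg n
  rw [← dist_eq_norm] at h5 hab
  have := dist_triangle4_right (⨍ s in B n, h s ∂μ) a (⨍ s in B n, g s ∂μ) b
  linarith

/-- Serves when the limit is not known in advance: the averages of h are Cauchy because they are
eventually close to the mean of an approximant. -/
theorem exists_hasMean_of_approx (hB : IsOpenFolnerSeq μ B) {h : G → ℂ} (hh : IsBddMeas h)
    (H : ∀ ε > 0, ∃ (g : G → ℂ) (b : ℂ), IsBddMeas g ∧ HasMean μ B g b ∧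
      ∀ᶠ n in atTop, ⨍ s in B n, ‖h s - g s‖ ∂μ ≤ ε) : ∃ a, HasMean μ B h a := by
  refine cauchySeq_tendsto_of_complete (Metric.cauchySeq_iff'.2 fun ε hε => ?_)
  obtain ⟨g, b, hg, hgb, hev⟩ := H (ε / 8) (by positivity)
  have h2 := Metric.tendsto_nhds.1 hgb (ε / 8) (by positivity)
  obtain ⟨N, hN⟩ := eventually_atTop.1 (hev.and h2)
  refine ⟨N, fun n hn => ?_⟩
  have key : ∀ n ≥ N, dist (⨍ s in B n, h s ∂μ) b < ε / 2 := fun n hn => by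
    obtain ⟨h3, h4⟩ := hN n hn
    have h5 := norm_setAverage_sub_le hB hh hg n
    rw [← dist_eq_norm] at h5
    have := dist_triangle (⨍ s in B n, h s ∂μ) (⨍ s in B n, g s ∂μ) b
    linarith
  have := dist_triangle_right (⨍ s in B n, h s ∂μ) (⨍ s in B N, h s ∂μ) b
  linarith [key n hn, key N le_rfl]

/-! ### Characters and trigonometric polynomials -/

theorem dualChar_add (ξ : DualChar G) (s t : G) :
    (ξ.1 (s + t) : ℂ) = (ξ.1 s : ℂ) * (ξ.1 t : ℂ) := by
  rw [AddChar.map_add_eq_mul, Circle.coe_mul]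

theorem dualChar_mul_conj (ξ : DualChar G) (t : G) :
    (ξ.1 t : ℂ) * (starRingEnd ℂ) (ξ.1 t : ℂ) = 1 := by
  rw [Complex.mul_conj, Complex.normSq_eq_norm_sq, Circle.norm_coe]
  simp

theorem isBddMeas_dualChar (ξ : DualChar G) : IsBddMeas (fun t : G => (ξ.1 t : ℂ)) :=
  ⟨(continuous_subtype_val.comp ξ.2).measurable, 1, fun _ => (Circle.norm_coe _).le⟩

/-- For ξ ≠ η the quotient character u has some u t ≠ 1. Translation by t multiplies its averages by
u t, yet changes them by a null sequence, so they tend to 0. -/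
theorem hasMean_dualChar_mul_conj [DecidableEq (DualChar G)] (hB : IsOpenFolnerSeq μ B)
    (ξ η : DualChar G) :
    HasMean μ B (fun t => (ξ.1 t : ℂ) * (starRingEnd ℂ) (η.1 t : ℂ)) (if ξ = η then 1 else 0) := by
  split_ifs with h
  · subst h
    simp only [dualChar_mul_conj]
    exact HasMean.const hB 1
  · obtain ⟨t, ht⟩ : ∃ t, ξ.1 t ≠ η.1 t := by
      by_contra! hc
      exact h (Subtype.ext (DFunLike.ext _ _ hc))
    set u : G → ℂ := fun t => (ξ.1 t : ℂ) * (starRingEnd ℂ) (η.1 t : ℂ) with hu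
    have hbu : IsBddMeas u := (isBddMeas_dualChar ξ).mul (isBddMeas_dualChar η).conj
    have hadd : ∀ s, u (s + t) = u t * u s := fun s => by
      simp only [hu, dualChar_add, map_mul]; ring
    have hne : u t - 1 ≠ 0 := by
      intro h0
      apply ht
      apply Circle.ext
      have h1 : (ξ.1 t : ℂ) * (starRingEnd ℂ) (η.1 t : ℂ) = 1 := sub_eq_zero.1 h0
      have h2 := dualChar_mul_conj η t
      calc (ξ.1 t : ℂ) = ξ.1 t * (η.1 t * (starRingEnd ℂ) (η.1 t : ℂ)) := by rw [h2, mul_one]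
        _ = (ξ.1 t * (starRingEnd ℂ) (η.1 t : ℂ)) * η.1 t := by ring
        _ = η.1 t := by rw [h1, one_mul]
    have h1 := tendsto_setAverage_translate hB hbu t
    have h2 := h1.const_mul (u t - 1)⁻¹
    rw [mul_zero] at h2
    refine h2.congr fun n => ?_
    have h3 : ⨍ s in B n, u (s + t) ∂μ = u t * ⨍ s in B n, u s ∂μ := by
      simp only [hadd]
      exact integral_const_mul _ _
    rw [h3]
    field_simp

/-- Trigonometric polynomials: linear combinations of characters. -/
def trigPoly (G : Type*) [AddCommGroup G] [TopologicalSpace G] : Submodule ℂ (G → ℂ) :=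
  Submodule.span ℂ (Set.range fun (ξ : DualChar G) (t : G) => (ξ.1 t : ℂ))

theorem dualChar_mem_trigPoly (ξ : DualChar G) : (fun t : G => (ξ.1 t : ℂ)) ∈ trigPoly G :=
  Submodule.subset_span ⟨ξ, rfl⟩

theorem mem_trigPoly_iff_fin {Q : G → ℂ} :
    Q ∈ trigPoly G ↔ ∃ (k : ℕ) (ξ : Fin k → DualChar G) (c : Fin k → ℂ),
      Q = fun s => ∑ j, c j * ((ξ j).1 s : ℂ) := by
  constructor
  · intro hQ
    obtain ⟨k, c, g, rfl⟩ := Submodule.mem_span_set'.1 hQ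
    choose ξ hξ using fun i => (g i).2
    refine ⟨k, ξ, c, ?_⟩
    funext s
    simp [← hξ]
  · rintro ⟨k, ξ, c, rfl⟩
    have : (fun s => ∑ j, c j * ((ξ j).1 s : ℂ)) =
        ∑ j, c j • (fun s : G => ((ξ j).1 s : ℂ)) := by
      funext s; simp
    rw [this]
    exact Submodule.sum_mem _ fun j _ => Submodule.smul_mem _ _ (dualChar_mem_trigPoly _)

theorem mem_trigPoly_iff_finset {Q : G → ℂ} :
    Q ∈ trigPoly G ↔ ∃ (F : Finset (DualChar G)) (c : DualChar G → ℂ),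
      Q = fun s => ∑ ξ ∈ F, c ξ * (ξ.1 s : ℂ) := by
  constructor
  · intro hQ
    obtain ⟨c, rfl⟩ := (Finsupp.mem_span_range_iff_exists_finsupp).1 hQ
    refine ⟨c.support, c, ?_⟩
    funext s
    simp [Finsupp.sum]
  · rintro ⟨F, c, rfl⟩
    have : (fun s => ∑ ξ ∈ F, c ξ * (ξ.1 s : ℂ)) = ∑ ξ ∈ F, c ξ • (fun s : G => (ξ.1 s : ℂ)) := by
      funext s; simp
    rw [this]
    exact Submodule.sum_mem _ fun j _ => Submodule.smul_mem _ _ (dualChar_mem_trigPoly _)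

theorem one_mem_trigPoly : (fun _ : G => (1 : ℂ)) ∈ trigPoly G := by
  have : (fun _ : G => (1 : ℂ)) = fun t => (((1 : AddChar G Circle)) t : ℂ) := by simp
  rw [this]
  exact dualChar_mem_trigPoly ⟨1, by simpa using! continuous_const⟩

theorem mul_mem_trigPoly {P Q : G → ℂ} (hP : P ∈ trigPoly G) (hQ : Q ∈ trigPoly G) :
    P * Q ∈ trigPoly G := by
  have key := Submodule.mul_mem_mul hP hQ
  rw [trigPoly, Submodule.span_mul_span] at key
  refine Submodule.span_mono ?_ key
  rintro _ ⟨_, ⟨ξ, rfl⟩, _, ⟨η, rfl⟩, rfl⟩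
  exact ⟨⟨ξ.1 * η.1, ξ.2.mul η.2⟩, by funext t; simp⟩

theorem conj_mem_trigPoly {P : G → ℂ} (hP : P ∈ trigPoly G) :
    (fun t => (starRingEnd ℂ) (P t)) ∈ trigPoly G := by
  induction hP using Submodule.span_induction with
  | mem x hx =>
    obtain ⟨ξ, rfl⟩ := hx
    have : (fun t : G => (starRingEnd ℂ) (ξ.1 t : ℂ)) =
        fun t => ((ξ.1⁻¹ : AddChar G Circle) t : ℂ) := by
      funext t
      rw [← Circle.coe_inv_eq_conj, AddChar.inv_apply']
    rw [this]
    refine dualChar_mem_trigPoly ⟨ξ.1⁻¹, ?_⟩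
    exact (ξ.2.comp continuous_neg).congr fun t => (AddChar.inv_apply _ _).symm
  | zero => exact (congrArg (· ∈ trigPoly G) (by funext t; simp)).mpr (trigPoly G).zero_mem
  | add x y _ _ hx hy => simpa using! (trigPoly G).add_mem hx hy
  | smul c x _ hx => simpa using! (trigPoly G).smul_mem (starRingEnd ℂ c) hx

theorem translate_mem_trigPoly {P : G → ℂ} (hP : P ∈ trigPoly G) (t : G) :
    (fun s => P (s + t)) ∈ trigPoly G := by
  induction hP using Submodule.span_induction with
  | mem x hx =>
    obtain ⟨ξ, rfl⟩ := hx
    simp only [dualChar_add, mul_comm _ (ξ.1 t : ℂ)]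
    exact (trigPoly G).smul_mem (ξ.1 t : ℂ) (dualChar_mem_trigPoly ξ)
  | zero => exact (congrArg (· ∈ trigPoly G) (by funext t; simp)).mpr (trigPoly G).zero_mem
  | add x y _ _ hx hy => simpa using! (trigPoly G).add_mem hx hy
  | smul c x _ hx => simpa using! (trigPoly G).smul_mem c hx

theorem isBddMeas_of_mem_trigPoly {P : G → ℂ} (hP : P ∈ trigPoly G) : IsBddMeas P := by
  obtain ⟨F, c, rfl⟩ := mem_trigPoly_iff_finset.1 hP
  exact IsBddMeas.sum F fun ξ => (IsBddMeas.const (c ξ)).mul (isBddMeas_dualChar ξ)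

theorem exists_hasMean_mul_conj (hB : IsOpenFolnerSeq μ B) {P : G → ℂ} (hP : P ∈ trigPoly G)
    (η : DualChar G) : ∃ a, HasMean μ B (fun t => P t * (starRingEnd ℂ) (η.1 t : ℂ)) a := by
  classical
  obtain ⟨F, c, rfl⟩ := mem_trigPoly_iff_finset.1 hP
  simp only [Finset.sum_mul, mul_assoc]
  exact ⟨_, HasMean.sum hB F (fun ξ => (hasMean_dualChar_mul_conj hB ξ η).const_mul (c ξ))
    fun ξ => (IsBddMeas.const _).mul ((isBddMeas_dualChar ξ).mul (isBddMeas_dualChar η).conj)⟩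

/-- Trigonometric polynomials form an algebra closed under conjugation, so they contain the powers
of |P|². This allows a truncation of P to be approximated without leaving them. -/
theorem polynomial_normSq_mul_mem_trigPoly {P : G → ℂ} (hP : P ∈ trigPoly G)
    (q : Polynomial ℝ) : (fun t => P t * (q.eval (‖P t‖ ^ 2) : ℝ)) ∈ trigPoly G := by
  induction q using Polynomial.induction_on' with
  | add p q hp hq =>
    simpa [mul_add] using! (trigPoly G).add_mem hp hq
  | monomial n a =>
    have hpow : (fun t => ((‖P t‖ ^ 2 : ℝ) : ℂ) ^ n) ∈ trigPoly G := by
      induction n with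
      | zero => simpa using one_mem_trigPoly
      | succ n ih =>
        have h1 := mul_mem_trigPoly ih (mul_mem_trigPoly hP (conj_mem_trigPoly hP))
        convert h1 using 1
        funext t
        simp only [Pi.mul_apply, Complex.mul_conj, Complex.normSq_eq_norm_sq, pow_succ]
    have h2 := (trigPoly G).smul_mem (a : ℂ) (mul_mem_trigPoly hP hpow)
    convert h2 using 1
    funext t
    simp only [Polynomial.eval_monomial, Pi.smul_apply, Pi.mul_apply, smul_eq_mul]
    push_cast
    ring

end Means

/-! ### Besicovitch almost periodic functions: quadratic approximation and Fourier–Bohr coefficients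
-/

section BesicovitchAP

variable {G : Type*} [AddCommGroup G] [TopologicalSpace G] [IsTopologicalAddGroup G]
  [MeasurableSpace G] [BorelSpace G] {μ : Measure G} [μ.IsAddHaarMeasure] {B : ℕ → Set G}

theorem isBesicovitchAPFun_iff (hB : IsOpenFolnerSeq μ B) {h : G → ℂ} :
    IsBesicovitchAPFun μ B h ↔ IsBddMeas h ∧ ∀ ε : ℝ, 0 < ε → ∃ Q ∈ trigPoly G,
      ∀ᶠ n in atTop, ⨍ s in B n, ‖h s - Q s‖ ∂μ ≤ ε := by
  constructor
  · rintro ⟨h1, h2, h3⟩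
    have hh : IsBddMeas h := ⟨h1, h2⟩
    refine ⟨hh, fun ε hε => ?_⟩
    obtain ⟨k, ξ, c, hlt⟩ := h3 ε hε
    have hQ := mem_trigPoly_iff_fin.2 ⟨k, ξ, c, rfl⟩
    refine ⟨_, hQ, ?_⟩
    have hb := (hh.sub (isBddMeas_of_mem_trigPoly hQ)).norm
    obtain ⟨D, hD⟩ := hb.2
    -- A real `limsup` below ε yields an eventual bound only for a sequence bounded above;
    -- boundedness of h and of the trigonometric polynomial provides this.
    have hbd : IsBoundedUnder (· ≤ ·) atTop
        (fun n => ⨍ s in B n, ‖h s - ∑ j, c j * ((ξ j).1 s : ℂ)‖ ∂μ) :=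
      isBoundedUnder_of ⟨D, fun n =>
        setAverage_le_const hB hb (fun t => (le_abs_self _).trans (hD t)) n⟩
    filter_upwards [eventually_lt_of_limsup_lt hlt hbd] with n hn using hn.le
  · rintro ⟨hh, H⟩
    refine ⟨hh.1, hh.2, fun ε hε => ?_⟩
    obtain ⟨Q, hQ, hev⟩ := H (ε / 2) (by positivity)
    obtain ⟨k, ξ, c, rfl⟩ := mem_trigPoly_iff_fin.1 hQ
    refine ⟨k, ξ, c, (limsup_le_of_le ?_ hev).trans_lt (by linarith)⟩
    exact (isBoundedUnder_of ⟨0, fun n =>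
      integral_nonneg fun _ => norm_nonneg _⟩ : IsBoundedUnder (· ≥ ·) atTop _).isCoboundedUnder_le

/-- Radial truncation: `C / max C ‖z‖ • z` has norm at most `C`, and it is not further from `z` than
any vector of norm at most `C`. -/
theorem norm_radialTruncation {C : ℝ} (hC : 0 < C) (z : ℂ) :
    ‖z * ((C / max C ‖z‖ : ℝ) : ℂ)‖ ≤ C ∧
      ∀ w : ℂ, ‖w‖ ≤ C → ‖z * ((C / max C ‖z‖ : ℝ) : ℂ) - z‖ ≤ ‖w - z‖ := by
  have hm : 0 < max C ‖z‖ := lt_max_of_lt_left hC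
  constructor
  · rw [norm_mul, Complex.norm_real, Real.norm_of_nonneg (by positivity), mul_div_assoc',
      div_le_iff₀ hm, mul_comm]
    exact mul_le_mul_of_nonneg_left (le_max_right _ _) hC.le
  · intro w hw
    rcases le_total ‖z‖ C with h | h
    · rw [max_eq_left h, div_self hC.ne']
      simp
    · rw [max_eq_right h] at *
      have h1 : z * ((C / ‖z‖ : ℝ) : ℂ) - z = z * ((C / ‖z‖ - 1 : ℝ) : ℂ) := by
        push_cast; ring
      have h2 : C / ‖z‖ - 1 ≤ 0 := sub_nonpos.2 ((div_le_one hm).2 h)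
      rw [h1, norm_mul, Complex.norm_real, Real.norm_of_nonpos h2]
      have h3 : ‖z‖ * -(C / ‖z‖ - 1) = ‖z‖ - C := by
        field_simp
        ring
      rw [h3, norm_sub_rev]
      linarith [norm_sub_norm_le z w]

/-- Bounded Besicovitch almost periodic functions are approximated by trigonometric polynomials in
quadratic mean. -/
theorem IsBesicovitchAPFun.exists_quadratic_approx (hB : IsOpenFolnerSeq μ B) {h : G → ℂ}
    (hh : IsBesicovitchAPFun μ B h) {ε : ℝ} (hε : 0 < ε) :
    ∃ Q ∈ trigPoly G, ∀ᶠ n in atTop, ⨍ s in B n, ‖h s - Q s‖ ^ 2 ∂μ ≤ ε := by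
  obtain ⟨hbdd, happ⟩ := (isBesicovitchAPFun_iff hB).1 hh
  obtain ⟨C, hCpos, hC⟩ : ∃ C : ℝ, 0 < C ∧ ∀ t, ‖h t‖ ≤ C := by
    obtain ⟨C, hC⟩ := hbdd.2
    exact ⟨max C 1, by positivity, fun t => (hC t).trans (le_max_left _ _)⟩
  -- The final bound is (2 * C + 1) * (2 * δ + δ) ≤ ε, whence the second entry. The first keeps ‖h -
  -- Q‖ below 2 * C + 1, independently of the uncontrolled bound M of P.
  set δ : ℝ := min 1 (ε / (3 * (2 * C + 1))) with hδ
  have hδpos : 0 < δ := by positivity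
  obtain ⟨P, hP, hev⟩ := happ δ hδpos
  have hPb := isBddMeas_of_mem_trigPoly hP
  obtain ⟨M, hMpos, hM⟩ : ∃ M : ℝ, 0 < M ∧ ∀ t, ‖P t‖ ≤ M := by
    obtain ⟨C, hC⟩ := hPb.2
    exact ⟨max C 1, by positivity, fun t => (hC t).trans (le_max_left _ _)⟩
  -- Q = P · q(|P|²) imitates the truncation of P at radius C: an error δ / M of q on [0, M²] moves
  -- Q at most δ away from it.
  have hcont : Continuous fun r : ℝ => C / max C (√r) :=
    continuous_const.div (continuous_const.max Real.continuous_sqrt)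
      fun r => (lt_max_of_lt_left hCpos).ne'
  obtain ⟨q, hq⟩ := exists_polynomial_near_of_continuousOn 0 (M ^ 2) _ hcont.continuousOn
    (δ / M) (by positivity)
  have hQ := polynomial_normSq_mul_mem_trigPoly hP q
  refine ⟨_, hQ, ?_⟩
  have hQb := isBddMeas_of_mem_trigPoly hQ
  -- One factor of the square is bounded uniformly, the other is small in mean.
  have hpt : ∀ t, ‖h t - P t * (q.eval (‖P t‖ ^ 2) : ℝ)‖ ^ 2 ≤
      (2 * C + 1) * (2 * ‖h t - P t‖ + δ) := by
    intro t
    obtain ⟨h1, h2⟩ := norm_radialTruncation hCpos (P t)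
    set T : ℂ := P t * ((C / max C ‖P t‖ : ℝ) : ℂ)
    set Qt : ℂ := P t * (q.eval (‖P t‖ ^ 2) : ℝ)
    have h3 := h2 (h t) (hC t)
    have h4 : ‖Qt - T‖ ≤ δ := by
      have h5 := hq (‖P t‖ ^ 2) ⟨by positivity, pow_le_pow_left₀ (norm_nonneg _) (hM t) 2⟩
      rw [Real.sqrt_sq (norm_nonneg _)] at h5
      have h6 : Qt - T = P t * ((q.eval (‖P t‖ ^ 2) - C / max C ‖P t‖ : ℝ) : ℂ) := by
        rw [Complex.ofReal_sub, mul_sub]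
      rw [h6, norm_mul, Complex.norm_real, Real.norm_eq_abs]
      calc _ ≤ M * (δ / M) := mul_le_mul (hM t) h5.le (abs_nonneg _) hMpos.le
        _ = δ := by field_simp
    have h7 : ‖h t - Qt‖ ≤ 2 * ‖h t - P t‖ + δ := by
      have e : h t - Qt = (h t - P t) - (T - P t) - (Qt - T) := by ring
      rw [e]
      linarith [norm_sub_le ((h t - P t) - (T - P t)) (Qt - T), norm_sub_le (h t - P t) (T - P t)]
    have h8 : ‖h t - Qt‖ ≤ 2 * C + 1 := by
      have e : h t - Qt = (h t - T) - (Qt - T) := by ring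
      rw [e]
      linarith [norm_sub_le (h t - T) (Qt - T), norm_sub_le (h t) T, hC t,
        min_le_left 1 (ε / (3 * (2 * C + 1)))]
    rw [pow_two]
    exact mul_le_mul h8 h7 (norm_nonneg _) (by positivity)
  filter_upwards [hev] with n hn
  have hb1 : IsBddMeas fun t => 2 * ‖h t - P t‖ := by
    have := (hbdd.sub hPb).norm
    simpa [two_mul] using this.add this
  have hb2 : IsBddMeas fun t => (2 * C + 1) * (2 * ‖h t - P t‖ + δ) := by
    have := hb1.add (IsBddMeas.const δ)
    obtain ⟨m1, D, hD⟩ := this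
    exact ⟨m1.const_mul _, (2 * C + 1) * D, fun t => by
      rw [norm_mul, Real.norm_of_nonneg (by positivity)]
      exact mul_le_mul_of_nonneg_left (hD t) (by positivity)⟩
  refine (setAverage_mono (hbdd.sub hQb).sq_norm hb2 hpt n).trans ?_
  have hd : ⨍ _ in B n, δ ∂μ ≤ δ := setAverage_le_const hB (IsBddMeas.const δ) (fun _ => le_rfl) n
  rw [setAverage_const_mul, setAverage_add hb1 (IsBddMeas.const δ), setAverage_const_mul]
  calc (2 * C + 1) * (2 * ⨍ s in B n, ‖h s - P s‖ ∂μ + ⨍ _ in B n, δ ∂μ)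
      ≤ (2 * C + 1) * (2 * δ + δ) := by gcongr
    _ = δ * (3 * (2 * C + 1)) := by ring
    _ ≤ ε := (le_div_iff₀ (by positivity)).1 (min_le_right _ _)

theorem IsBesicovitchAPFun.exists_hasMean (hB : IsOpenFolnerSeq μ B) {h : G → ℂ}
    (hh : IsBesicovitchAPFun μ B h) (ξ : DualChar G) :
    ∃ a, HasMean μ B (fun t => h t * (starRingEnd ℂ) (ξ.1 t : ℂ)) a := by
  obtain ⟨hbdd, happ⟩ := (isBesicovitchAPFun_iff hB).1 hh
  have hc := (isBddMeas_dualChar ξ).conj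
  refine exists_hasMean_of_approx hB (hbdd.mul hc) fun ε hε => ?_
  obtain ⟨Q, hQ, hev⟩ := happ ε hε
  obtain ⟨b, hb⟩ := exists_hasMean_mul_conj hB hQ ξ
  refine ⟨_, b, (isBddMeas_of_mem_trigPoly hQ).mul hc, hb, ?_⟩
  simpa [← sub_mul, Circle.norm_coe] using hev

theorem IsBesicovitchAPFun.translate (hB : IsOpenFolnerSeq μ B) {h : G → ℂ}
    (hh : IsBesicovitchAPFun μ B h) (t : G) : IsBesicovitchAPFun μ B (fun s => h (s + t)) := by
  rw [isBesicovitchAPFun_iff hB] at hh ⊢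
  obtain ⟨hbdd, happ⟩ := hh
  refine ⟨hbdd.comp (measurable_add_const t), fun ε hε => ?_⟩
  obtain ⟨Q, hQ, hev⟩ := happ (ε / 2) (by positivity)
  refine ⟨_, translate_mem_trigPoly hQ t, ?_⟩
  have h1 := tendsto_setAverage_translate hB (hbdd.sub (isBddMeas_of_mem_trigPoly hQ)).norm t
  filter_upwards [hev, h1.eventually (gt_mem_nhds (half_pos hε))] with n h2 h3
  linarith

/-- The mean square of `h - ∑ c ξ`, expressed by the Fourier-Bohr coefficients of `h`. -/
theorem hasMean_normSq_sub_sum (hB : IsOpenFolnerSeq μ B) {h : G → ℂ} (hh : IsBddMeas h)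
    {N : ℝ} (hN : HasMean μ B (fun t => h t * (starRingEnd ℂ) (h t)) N) {a : DualChar G → ℂ}
    (ha : ∀ ξ, HasMean μ B (fun t => h t * (starRingEnd ℂ) (ξ.1 t : ℂ)) (a ξ))
    (F : Finset (DualChar G)) (c : DualChar G → ℂ) :
    Tendsto (fun n => ⨍ s in B n, ‖h s - ∑ ξ ∈ F, c ξ * (ξ.1 s : ℂ)‖ ^ 2 ∂μ) atTop
      (𝓝 (N - ∑ ξ ∈ F, ‖a ξ‖ ^ 2 + ∑ ξ ∈ F, ‖a ξ - c ξ‖ ^ 2)) := by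
  classical
  have hχ := fun ξ : DualChar G => isBddMeas_dualChar ξ
  have m1 : HasMean μ B (fun t => ∑ ξ ∈ F, (starRingEnd ℂ) (c ξ) *
      (h t * (starRingEnd ℂ) (ξ.1 t : ℂ))) (∑ ξ ∈ F, (starRingEnd ℂ) (c ξ) * a ξ) :=
    HasMean.sum hB F (fun ξ => (ha ξ).const_mul _)
      fun ξ => (IsBddMeas.const _).mul (hh.mul (hχ ξ).conj)
  have b1 : IsBddMeas (fun t => ∑ ξ ∈ F, (starRingEnd ℂ) (c ξ) *
      (h t * (starRingEnd ℂ) (ξ.1 t : ℂ))) :=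
    IsBddMeas.sum F fun ξ => (IsBddMeas.const _).mul (hh.mul (hχ ξ).conj)
  have b3 : ∀ ξ, IsBddMeas (fun t => ∑ η ∈ F, (c ξ * (starRingEnd ℂ) (c η)) *
      ((ξ.1 t : ℂ) * (starRingEnd ℂ) (η.1 t : ℂ))) := fun ξ =>
    IsBddMeas.sum F fun η => (IsBddMeas.const _).mul ((hχ ξ).mul (hχ η).conj)
  have m3 : HasMean μ B (fun t => ∑ ξ ∈ F, ∑ η ∈ F, (c ξ * (starRingEnd ℂ) (c η)) *
      ((ξ.1 t : ℂ) * (starRingEnd ℂ) (η.1 t : ℂ)))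
      (∑ ξ ∈ F, ∑ η ∈ F, (c ξ * (starRingEnd ℂ) (c η)) * (if ξ = η then 1 else 0)) :=
    HasMean.sum hB F (fun ξ => HasMean.sum hB F
      (fun η => (hasMean_dualChar_mul_conj hB ξ η).const_mul _)
      fun η => (IsBddMeas.const _).mul ((hχ ξ).mul (hχ η).conj)) b3
  -- With S = ∑ c ξ, this is the termwise mean of |h|² - h conj S - conj (h conj S) + |S|².
  -- Completing the square in each coefficient then gives the stated limit.
  have m4 := ((hN.sub m1 (hh.mul hh.conj) b1).sub m1.conj
    ((hh.mul hh.conj).sub b1) b1.conj).add m3 (((hh.mul hh.conj).sub b1).sub b1.conj)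
    (IsBddMeas.sum F b3)
  have hlim : (N : ℂ) - ∑ ξ ∈ F, (starRingEnd ℂ) (c ξ) * a ξ -
      (starRingEnd ℂ) (∑ ξ ∈ F, (starRingEnd ℂ) (c ξ) * a ξ) +
      ∑ ξ ∈ F, ∑ η ∈ F, (c ξ * (starRingEnd ℂ) (c η)) * (if ξ = η then 1 else 0) =
      ((N - ∑ ξ ∈ F, ‖a ξ‖ ^ 2 + ∑ ξ ∈ F, ‖a ξ - c ξ‖ ^ 2 : ℝ) : ℂ) := by
    have e1 : ∀ ξ ∈ F, ∑ η ∈ F, (c ξ * (starRingEnd ℂ) (c η)) * (if ξ = η then (1 : ℂ) else 0) =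
        c ξ * (starRingEnd ℂ) (c ξ) := fun ξ hξ => by
      simp [hξ]
    rw [Finset.sum_congr rfl e1]
    push_cast
    simp only [map_sum, map_mul, Complex.conj_conj, sub_eq_add_neg, ← Finset.sum_neg_distrib,
      add_assoc, ← Finset.sum_add_distrib]
    congr 1
    refine Finset.sum_congr rfl fun ξ _ => ?_
    have e2 : ∀ z : ℂ, (‖z‖ : ℂ) ^ 2 = z * (starRingEnd ℂ) z := fun z => by
      rw [Complex.mul_conj, Complex.normSq_eq_norm_sq]; push_cast; rfl
    rw [e2, e2]
    simp only [map_add, map_neg]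
    ring
  rw [hlim] at m4
  have hfun : ∀ t, h t * (starRingEnd ℂ) (h t) - (∑ ξ ∈ F, (starRingEnd ℂ) (c ξ) *
      (h t * (starRingEnd ℂ) (ξ.1 t : ℂ))) - (starRingEnd ℂ) (∑ ξ ∈ F, (starRingEnd ℂ) (c ξ) *
      (h t * (starRingEnd ℂ) (ξ.1 t : ℂ))) + ∑ ξ ∈ F, ∑ η ∈ F, (c ξ * (starRingEnd ℂ) (c η)) *
      ((ξ.1 t : ℂ) * (starRingEnd ℂ) (η.1 t : ℂ)) =
      ((‖h t - ∑ ξ ∈ F, c ξ * (ξ.1 t : ℂ)‖ ^ 2 : ℝ) : ℂ) := by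
    intro t
    rw [← Complex.normSq_eq_norm_sq, ← Complex.mul_conj]
    set S := ∑ ξ ∈ F, c ξ * (ξ.1 t : ℂ) with hS
    have e1 : ∑ ξ ∈ F, (starRingEnd ℂ) (c ξ) * (h t * (starRingEnd ℂ) (ξ.1 t : ℂ)) =
        h t * (starRingEnd ℂ) S := by
      rw [hS, map_sum, Finset.mul_sum]
      exact Finset.sum_congr rfl fun ξ _ => by rw [map_mul]; ring
    have e2 : ∑ ξ ∈ F, ∑ η ∈ F, (c ξ * (starRingEnd ℂ) (c η)) *
        ((ξ.1 t : ℂ) * (starRingEnd ℂ) (η.1 t : ℂ)) = S * (starRingEnd ℂ) S := by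
      rw [hS, map_sum, Finset.sum_mul_sum]
      exact Finset.sum_congr rfl fun ξ _ => Finset.sum_congr rfl fun η _ => by
        rw [map_mul]; ring
    rw [e1, e2]
    simp only [map_sub, map_mul, Complex.conj_conj]
    ring
  simp only [HasMean, hfun] at m4
  have m5 := (Complex.continuous_re.tendsto _).comp m4
  refine m5.congr fun n => ?_
  simp only [Function.comp_apply]
  have : ⨍ s in B n, ((‖h s - ∑ ξ ∈ F, c ξ * (ξ.1 s : ℂ)‖ ^ 2 : ℝ) : ℂ) ∂μ =
      ((⨍ s in B n, ‖h s - ∑ ξ ∈ F, c ξ * (ξ.1 s : ℂ)‖ ^ 2 ∂μ : ℝ) : ℂ) := integral_ofReal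
  rw [this, Complex.ofReal_re]

end BesicovitchAP

/-! ### Koopman operators, eigenspaces and almost every orbit -/

section Koopman

variable {G X : Type*} [AddCommGroup G] [TopologicalSpace G] [IsTopologicalAddGroup G] [T2Space G]
  [LocallyCompactSpace G] [SigmaCompactSpace G] [MeasurableSpace G] [BorelSpace G]
  {μ : Measure G} [μ.IsAddHaarMeasure]
  [MetricSpace X] [CompactSpace X] [MeasurableSpace X] [BorelSpace X]
  [AddAction G X] [ContinuousVAdd G X]
  {m : Measure X} [IsProbabilityMeasure m] [VAddInvariantMeasure G X m]
  {B : ℕ → Set G}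

theorem koopman_ae_eq (t : G) (φ : Lp ℂ 2 m) : koopman m t φ =ᵐ[m] fun x => φ (t +ᵥ x) :=
  Lp.coeFn_compMeasurePreserving φ (measurePreserving_vadd t m)

/-- Translation of continuous functions. -/
noncomputable def translateFun (t : G) (f : C(X, ℂ)) : C(X, ℂ) := ⟨fun x => f (t +ᵥ x), by fun_prop⟩

theorem koopman_toLp (t : G) (f : C(X, ℂ)) :
    koopman m t (ContinuousMap.toLp 2 m ℂ f) = ContinuousMap.toLp 2 m ℂ (translateFun t f) := by
  refine Lp.ext ?_
  filter_upwards [koopman_ae_eq t (ContinuousMap.toLp 2 m ℂ f),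
    ContinuousMap.coeFn_toLp (p := 2) m (𝕜 := ℂ) (translateFun t f),
    (measurePreserving_vadd t m).quasiMeasurePreserving.ae
      (ContinuousMap.coeFn_toLp (p := 2) m (𝕜 := ℂ) f)] with x h1 h2 h3
  rw [h1, h2]
  exact h3

theorem koopman_add (s t : G) (φ : Lp ℂ 2 m) :
    koopman m (s + t) φ = koopman m s (koopman m t φ) := by
  refine Lp.ext ?_
  filter_upwards [koopman_ae_eq (s + t) φ, koopman_ae_eq s (koopman m t φ),
    (measurePreserving_vadd s m).quasiMeasurePreserving.ae (koopman_ae_eq t φ)] with x h1 h2 h3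
  rw [h1, h2, h3, vadd_vadd, add_comm]

/-- Currying the jointly continuous action makes t ↦ (x ↦ t x) continuous into C(X, X). Needed for
the continuity of the multipliers of an eigenfunction. -/
theorem continuous_koopman (φ : Lp ℂ 2 m) : Continuous fun t : G => koopman m t φ := by
  have h : Continuous fun t : G => (⟨fun x => t +ᵥ x, by fun_prop⟩ : C(X, X)) :=
    (ContinuousMap.mk (fun a : G × X => a.1 +ᵥ a.2) (by fun_prop)).curry.continuous
  exact (continuous_const (y := φ)).compMeasurePreservingLp h
    (fun t => measurePreserving_vadd t m) (by norm_num)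

/-- By invariance of m the exceptional set of x is null for each fixed t; Fubini exchanges the
quantifiers, after passing to a measurable null superset. -/
theorem ae_orbit {p : X → Prop} (hp : ∀ᵐ y ∂m, p y) : ∀ᵐ x ∂m, ∀ᵐ t ∂μ, p (t +ᵥ x) := by
  obtain ⟨s, hs, hsm, hms⟩ := exists_measurable_superset_of_null (ae_iff.1 hp)
  have hmeas : MeasurableSet {z : X × G | z.2 +ᵥ z.1 ∉ s} :=
    (show Measurable fun z : X × G => z.2 +ᵥ z.1 from
      (continuous_snd.vadd continuous_fst).measurable) hsm.compl
  have h1 : ∀ᵐ x ∂m, ∀ᵐ t ∂μ, t +ᵥ x ∉ s := by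
    rw [Measure.ae_ae_comm (p := fun (x : X) (t : G) => t +ᵥ x ∉ s) hmeas]
    refine ae_of_all _ fun t => ?_
    refine (measurePreserving_vadd t m).quasiMeasurePreserving.ae (p := fun y => y ∉ s) ?_
    rw [ae_iff]
    simpa using hms
  filter_upwards [h1] with x hx
  filter_upwards [hx] with t ht
  by_contra hc
  exact ht (hs hc)

theorem ae_orbit_of_forall {F : X → ℂ} (hF : StronglyMeasurable F) {u : G → ℂ} (hu : Measurable u)
    (h : ∀ t : G, ∀ᵐ x ∂m, F (t +ᵥ x) = u t * F x) :
    ∀ᵐ x ∂m, ∀ᵐ t ∂μ, F (t +ᵥ x) = u t * F x := by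
  have hact : Measurable fun z : X × G => z.2 +ᵥ z.1 :=
    (continuous_snd.vadd continuous_fst).measurable
  have hmeas : MeasurableSet {z : X × G | F (z.2 +ᵥ z.1) = u z.2 * F z.1} :=
    measurableSet_eq_fun (hF.measurable.comp hact)
      ((hu.comp measurable_snd).mul (hF.measurable.comp measurable_fst))
  rw [Measure.ae_ae_comm (p := fun (x : X) (t : G) => F (t +ᵥ x) = u t * F x) hmeas]
  exact ae_of_all _ h

/-- Integrable functions that are almost everywhere invariant under each group element are almost
everywhere constant. -/
theorem ae_eq_integral_of_invariant (hB : IsOpenFolnerSeq μ B) (hBirkhoff : BirkhoffHolds μ B m)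
    {F : X → ℂ} (hF : StronglyMeasurable F) (hFi : Integrable F m)
    (h : ∀ t : G, ∀ᵐ x ∂m, F (t +ᵥ x) = F x) : ∀ᵐ x ∂m, F x = ∫ y, F y ∂m := by
  -- Along almost every orbit F equals F x at almost every time, so its orbit mean is F x, while
  -- Birkhoff's theorem says that it is the integral.
  have h1 := ae_orbit_of_forall (μ := μ) hF (u := fun _ => 1) measurable_const (by simpa using h)
  filter_upwards [h1, hBirkhoff F hFi] with x hx hx2
  refine HasMean.unique (HasMean.congr_ae (HasMean.const hB (F x)) ?_) hx2
  filter_upwards [hx] with t ht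
  rw [orbitFun, ht, one_mul]

theorem ae_orbit_eigenspace {ξ : DualChar G} {φ : Lp ℂ 2 m} (hφ : φ ∈ eigenspace m ξ) :
    ∀ᵐ x ∂m, ∀ᵐ t ∂μ, φ (t +ᵥ x) = (ξ.1 t : ℂ) * φ x := by
  refine ae_orbit_of_forall (Lp.stronglyMeasurable φ) (isBddMeas_dualChar ξ).1 fun t => ?_
  have h := (mem_eigenspace_iff m ξ φ).1 hφ t
  have h2 := koopman_ae_eq t φ
  rw [h] at h2
  filter_upwards [h2, Lp.coeFn_smul (ξ.1 t : ℂ) φ] with x h3 h4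
  rw [← h3, h4]
  rfl

theorem integrable_mul_conj (φ ψ : Lp ℂ 2 m) :
    Integrable (fun x => ψ x * (starRingEnd ℂ) (φ x)) m :=
  L2.integrable_inner (𝕜 := ℂ) φ ψ

/-- The factors ξ t and conj (ξ t) cancel, so the product is invariant and hence constant. -/
theorem ae_mul_conj_eq_inner (hB : IsOpenFolnerSeq μ B) (hBirkhoff : BirkhoffHolds μ B m)
    {ξ : DualChar G} {φ ψ : Lp ℂ 2 m} (hφ : φ ∈ eigenspace m ξ) (hψ : ψ ∈ eigenspace m ξ) :
    ∀ᵐ x ∂m, ψ x * (starRingEnd ℂ) (φ x) = ⟪φ, ψ⟫_ℂ := by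
  have hsm : StronglyMeasurable fun x => ψ x * (starRingEnd ℂ) (φ x) :=
    (Lp.stronglyMeasurable ψ).mul
      (Complex.continuous_conj.comp_stronglyMeasurable (Lp.stronglyMeasurable φ))
  refine ae_eq_integral_of_invariant hB hBirkhoff hsm (integrable_mul_conj φ ψ) fun t => ?_
  have key : ∀ {χ : Lp ℂ 2 m}, χ ∈ eigenspace m ξ →
      ∀ᵐ x ∂m, χ (t +ᵥ x) = (ξ.1 t : ℂ) * χ x := fun {χ} hχ => by
    have h2 := koopman_ae_eq t χ
    rw [(mem_eigenspace_iff m ξ χ).1 hχ t] at h2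
    filter_upwards [h2, Lp.coeFn_smul (ξ.1 t : ℂ) χ] with x h3 h4
    rw [← h3, h4]
    rfl
  filter_upwards [key hφ, key hψ] with x h1 h2
  rw [h1, h2, map_mul]
  linear_combination ψ x * (starRingEnd ℂ) (φ x) * dualChar_mul_conj ξ t

/-- Equality in Cauchy–Schwarz: the eigenspace is at most one-dimensional. It follows by evaluating
at one point where |φ| = ‖φ‖, |ψ| = ‖ψ‖ and ψ conj φ is the inner product. -/
theorem norm_inner_eq_of_mem_eigenspace (hB : IsOpenFolnerSeq μ B)
    (hBirkhoff : BirkhoffHolds μ B m) {ξ : DualChar G} {φ ψ : Lp ℂ 2 m}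
    (hφ : φ ∈ eigenspace m ξ) (hψ : ψ ∈ eigenspace m ξ) : ‖⟪φ, ψ⟫_ℂ‖ = ‖φ‖ * ‖ψ‖ := by
  obtain ⟨x, h1, h2, h3⟩ := ((ae_mul_conj_eq_inner hB hBirkhoff hφ hψ).and
    ((ae_mul_conj_eq_inner hB hBirkhoff hφ hφ).and
      (ae_mul_conj_eq_inner hB hBirkhoff hψ hψ))).exists
  have e : ∀ {z : ℂ} {χ : Lp ℂ 2 m}, z * (starRingEnd ℂ) z = ⟪χ, χ⟫_ℂ → ‖z‖ = ‖χ‖ := by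
    intro z χ h
    have h4 := congrArg norm h
    rw [norm_mul, RCLike.norm_conj, inner_self_eq_norm_sq_to_K, norm_pow, RCLike.norm_ofReal,
      abs_norm, ← pow_two] at h4
    exact (pow_left_inj₀ (norm_nonneg _) (norm_nonneg _) two_ne_zero).1 h4
  rw [← h1, norm_mul, RCLike.norm_conj, e h2, e h3, mul_comm]

theorem inner_eq_zero_of_mem_eigenspace {ξ η : DualChar G} (hne : ξ ≠ η) {φ ψ : Lp ℂ 2 m}
    (hφ : φ ∈ eigenspace m ξ) (hψ : ψ ∈ eigenspace m η) : ⟪φ, ψ⟫_ℂ = 0 := by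
  obtain ⟨t, ht⟩ : ∃ t, ξ.1 t ≠ η.1 t := by
    by_contra! hc
    exact hne (Subtype.ext (DFunLike.ext _ _ hc))
  have h1 := (koopman m t).inner_map_map φ ψ
  rw [(mem_eigenspace_iff m ξ φ).1 hφ t, (mem_eigenspace_iff m η ψ).1 hψ t, inner_smul_left,
    inner_smul_right] at h1
  by_contra h0
  apply ht
  apply Circle.ext
  have h2 : (starRingEnd ℂ) (ξ.1 t : ℂ) * (η.1 t : ℂ) = 1 :=
    mul_right_cancel₀ h0 (by rw [mul_assoc, h1, one_mul])
  linear_combination (η.1 t : ℂ) * dualChar_mul_conj ξ t - (ξ.1 t : ℂ) * h2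

theorem denseRange_toLp : DenseRange (ContinuousMap.toLp (E := ℂ) 2 m ℂ) :=
  ContinuousMap.toLp_denseRange ℂ m ℂ (by norm_num)

/-- A vector `ψ` with `⟪ψ, U_t f⟫ = ξ t ⟪ψ, f⟫` for all continuous `f` is in the eigenspace of
`ξ`. -/
theorem mem_eigenspace_of_inner_koopman {ξ : DualChar G} {ψ : Lp ℂ 2 m}
    (h : ∀ (t : G) (f : C(X, ℂ)), ⟪ψ, koopman m t (ContinuousMap.toLp 2 m ℂ f)⟫_ℂ =
      (ξ.1 t : ℂ) * ⟪ψ, ContinuousMap.toLp 2 m ℂ f⟫_ℂ) : ψ ∈ eigenspace m ξ := by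
  rw [mem_eigenspace_iff]
  intro t
  -- Density of C(X) allows ψ itself as test vector; then ‖U_t ψ - ξ(t) ψ‖² expands to ‖ψ‖² (1 - 1 -
  -- 1 + 1) = 0.
  have h1 : ⟪ψ, koopman m t ψ⟫_ℂ = (ξ.1 t : ℂ) * ⟪ψ, ψ⟫_ℂ := by
    refine denseRange_toLp.induction_on ψ (p := fun φ => ⟪ψ, koopman m t φ⟫_ℂ =
      (ξ.1 t : ℂ) * ⟪ψ, φ⟫_ℂ) ?_ (h t)
    exact isClosed_eq (continuous_const.inner (koopman m t).continuous)
      (continuous_const.mul (continuous_const.inner continuous_id))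
  have h2 : ⟪koopman m t ψ, ψ⟫_ℂ = (starRingEnd ℂ) (ξ.1 t : ℂ) * ⟪ψ, ψ⟫_ℂ := by
    rw [← inner_conj_symm, h1, map_mul, inner_conj_symm]
  rw [← sub_eq_zero, ← inner_self_eq_zero (𝕜 := ℂ)]
  rw [inner_sub_left, inner_sub_right, inner_sub_right, inner_smul_left, inner_smul_right,
    inner_smul_left, inner_smul_right, (koopman m t).inner_map_map, h1, h2]
  linear_combination (-⟪ψ, ψ⟫_ℂ) * dualChar_mul_conj ξ t

/-- The multipliers of an eigenfunction form a continuous character. -/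
theorem IsEigenfunction.exists_mem_eigenspace {φ : Lp ℂ 2 m} (hφ : IsEigenfunction G m φ) :
    ∃ ξ : DualChar G, φ ∈ eigenspace m ξ := by
  obtain ⟨h0, h⟩ := hφ
  choose c hc using h
  have hn : ‖φ‖ ≠ 0 := norm_ne_zero_iff.2 h0
  have hc1 : ∀ t, ‖c t‖ = 1 := fun t => by
    have := (koopman m t).norm_map φ
    rw [hc t, norm_smul] at this
    exact mul_right_cancel₀ hn (by rw [this, one_mul])
  have hadd : ∀ s t, c (s + t) = c s * c t := fun s t => by
    have := koopman_add s t φ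
    rw [hc, hc t, map_smul, hc s, smul_smul] at this
    rw [smul_left_injective ℂ h0 this, mul_comm]
  have hcont : Continuous c := by
    have h1 : ∀ t, c t = ⟪φ, koopman m t φ⟫_ℂ / ⟪φ, φ⟫_ℂ := fun t => by
      rw [hc t, inner_smul_right, mul_div_assoc, div_self (inner_self_ne_zero.2 h0), mul_one]
    rw [show c = _ from funext h1]
    exact (continuous_const.inner (continuous_koopman φ)).div_const _
  have hz : c 0 = 1 := by
    have h1 := hadd 0 0
    rw [add_zero] at h1
    have h2 : c 0 ≠ 0 := norm_ne_zero_iff.1 (by rw [hc1]; exact one_ne_zero)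
    exact mul_right_cancel₀ h2 (by rw [← h1, one_mul])
  let u : G → Circle := fun t => ⟨c t, mem_sphere_zero_iff_norm.2 (hc1 t)⟩
  let ξ : AddChar G Circle :=
    { toFun := u
      map_zero_eq_one' := Circle.ext hz
      map_add_eq_mul' := fun s t => Circle.ext (hadd s t) }
  exact ⟨⟨ξ, hcont.subtype_mk _⟩, (mem_eigenspace_iff m _ φ).2 hc⟩

end Koopman

/-! ### Fourier–Bohr coefficients at a point of `Bap` -/

section BapPoints

variable {G X : Type*} [AddCommGroup G] [TopologicalSpace G] [IsTopologicalAddGroup G] [T2Space G]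
  [LocallyCompactSpace G] [SigmaCompactSpace G] [MeasurableSpace G] [BorelSpace G]
  {μ : Measure G} [μ.IsAddHaarMeasure]
  [MetricSpace X] [CompactSpace X] [MeasurableSpace X] [BorelSpace X]
  [AddAction G X] [ContinuousVAdd G X]
  {m : Measure X} [IsProbabilityMeasure m] [VAddInvariantMeasure G X m]
  {B : ℕ → Set G} {x : X}

theorem isBddMeas_orbitFun (f : C(X, ℂ)) (x : X) : IsBddMeas (orbitFun (G := G) f x) :=
  ⟨(by unfold orbitFun; fun_prop : Continuous (orbitFun (G := G) f x)).measurable, ‖f‖,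
    fun _ => f.norm_coe_le_norm _⟩

theorem isBddMeas_twistedOrbitFun (f : C(X, ℂ)) (ξ : DualChar G) (x : X) :
    IsBddMeas (twistedOrbitFun f ξ x) :=
  (isBddMeas_orbitFun f x).mul (isBddMeas_dualChar ξ).conj

theorem HasMean.mean_eq {h : G → ℂ} {a : ℂ} (ha : HasMean μ B h a) : mean μ B h = a :=
  Tendsto.limUnder_eq ha

/-- `mean` is informative only when the averages converge; almost periodicity of the orbit function
guarantees this on `Bap`. -/
theorem hasMean_twistedOrbitFun (hB : IsOpenFolnerSeq μ B) (hx : x ∈ Bap μ B m) (f : C(X, ℂ))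
    (ξ : DualChar G) :
    HasMean μ B (twistedOrbitFun f ξ x) (mean μ B (twistedOrbitFun f ξ x)) := by
  obtain ⟨a, ha⟩ := (hx.1 f).exists_hasMean hB ξ
  have ha' : HasMean μ B (twistedOrbitFun f ξ x) a := ha
  rwa [ha'.mean_eq]

theorem inner_toLp (f g : C(X, ℂ)) :
    ⟪ContinuousMap.toLp 2 m ℂ f, ContinuousMap.toLp 2 m ℂ g⟫_ℂ =
      ∫ y, g y * (starRingEnd ℂ) (f y) ∂m :=
  ContinuousMap.inner_toLp m f g

theorem hasMean_orbitFun_mul_conj (hx : x ∈ Bap μ B m) (f : C(X, ℂ)) :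
    HasMean μ B (fun t => orbitFun f x t * (starRingEnd ℂ) (orbitFun f x t))
      ((‖ContinuousMap.toLp 2 m ℂ f‖ ^ 2 : ℝ) : ℂ) := by
  have h1 := hx.2 (f * star f)
  have h2 : ∫ y, (f * star f) y ∂m = ((‖ContinuousMap.toLp 2 m ℂ f‖ ^ 2 : ℝ) : ℂ) := by
    have := inner_toLp (m := m) f f
    rw [inner_self_eq_norm_sq_to_K] at this
    push_cast
    exact this.symm
  rw [h2] at h1
  exact h1

theorem tendsto_quadratic (hB : IsOpenFolnerSeq μ B) (hx : x ∈ Bap μ B m) (f : C(X, ℂ))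
    (F : Finset (DualChar G)) (c : DualChar G → ℂ) :
    Tendsto (fun n => ⨍ s in B n, ‖orbitFun f x s - ∑ ξ ∈ F, c ξ * (ξ.1 s : ℂ)‖ ^ 2 ∂μ) atTop
      (𝓝 (‖ContinuousMap.toLp 2 m ℂ f‖ ^ 2 -
        ∑ ξ ∈ F, ‖mean μ B (twistedOrbitFun f ξ x)‖ ^ 2 +
        ∑ ξ ∈ F, ‖mean μ B (twistedOrbitFun f ξ x) - c ξ‖ ^ 2)) :=
  hasMean_normSq_sub_sum hB (isBddMeas_orbitFun f x) (hasMean_orbitFun_mul_conj hx f)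
    (fun ξ => hasMean_twistedOrbitFun hB hx f ξ) F c

/-- Bessel's inequality: with c the Fourier–Bohr coefficients themselves, the last sum in
`tendsto_quadratic` vanishes. -/
theorem sum_normSq_mean_le (hB : IsOpenFolnerSeq μ B) (hx : x ∈ Bap μ B m) (f : C(X, ℂ))
    (F : Finset (DualChar G)) :
    ∑ ξ ∈ F, ‖mean μ B (twistedOrbitFun f ξ x)‖ ^ 2 ≤ ‖ContinuousMap.toLp 2 m ℂ f‖ ^ 2 := by
  have h := ge_of_tendsto'
    (tendsto_quadratic hB hx f F (fun ξ => mean μ B (twistedOrbitFun f ξ x)))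
    (fun n => integral_nonneg fun _ => by positivity : ∀ n, (0 : ℝ) ≤ _)
  simp at h
  linarith

/-- The other half of Parseval: replacing the coefficients of an approximating polynomial by the
Fourier–Bohr coefficients only lowers the quadratic error. -/
theorem exists_sum_normSq_mean_ge (hB : IsOpenFolnerSeq μ B) (hx : x ∈ Bap μ B m) (f : C(X, ℂ))
    {ε : ℝ} (hε : 0 < ε) : ∃ F : Finset (DualChar G), ‖ContinuousMap.toLp 2 m ℂ f‖ ^ 2 -
      ∑ ξ ∈ F, ‖mean μ B (twistedOrbitFun f ξ x)‖ ^ 2 ≤ ε := by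
  obtain ⟨Q, hQ, hev⟩ := (hx.1 f).exists_quadratic_approx hB hε
  obtain ⟨F, c, rfl⟩ := mem_trigPoly_iff_finset.1 hQ
  refine ⟨F, ?_⟩
  have h := le_of_tendsto (tendsto_quadratic hB hx f F c) hev
  have h2 : 0 ≤ ∑ ξ ∈ F, ‖mean μ B (twistedOrbitFun f ξ x) - c ξ‖ ^ 2 :=
    Finset.sum_nonneg fun _ _ => by positivity
  linarith

theorem orbitFun_vadd (f : X → ℂ) (t s : G) (x : X) :
    orbitFun f (t +ᵥ x) s = orbitFun f x (s + t) := by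
  simp [orbitFun, vadd_vadd]

theorem orbitFun_translateFun (f : C(X, ℂ)) (t s : G) (x : X) :
    orbitFun (translateFun t f) x s = orbitFun f x (s + t) := by
  simp [orbitFun, translateFun, vadd_vadd, add_comm]

/-- The function h is left free so that it can come from a translate of f as well as from a
translate of x. -/
theorem hasMean_twisted_of_translate (hB : IsOpenFolnerSeq μ B) {f : C(X, ℂ)} {ξ : DualChar G}
    {a : ℂ} (ha : HasMean μ B (twistedOrbitFun f ξ x) a) (t : G) {h : G → ℂ}
    (hh : ∀ s, h s = orbitFun f x (s + t) * (starRingEnd ℂ) (ξ.1 s : ℂ)) :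
    HasMean μ B h ((ξ.1 t : ℂ) * a) := by
  have h1 := (ha.translate hB (isBddMeas_twistedOrbitFun f ξ x) t).const_mul (ξ.1 t : ℂ)
  convert h1 using 2 with s
  rw [hh s, twistedOrbitFun, dualChar_add, map_mul]
  linear_combination -(orbitFun f x (s + t) * (starRingEnd ℂ) (ξ.1 s : ℂ)) * dualChar_mul_conj ξ t

theorem vadd_mem_Bap (hB : IsOpenFolnerSeq μ B) (hx : x ∈ Bap μ B m) (t : G) :
    t +ᵥ x ∈ Bap μ B m := by
  refine ⟨fun f => ?_, fun f => ?_⟩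
  · rw [show orbitFun (G := G) f (t +ᵥ x) = _ from funext fun s => orbitFun_vadd f t s x]
    exact (hx.1 f).translate hB t
  · rw [show orbitFun (G := G) f (t +ᵥ x) = _ from funext fun s => orbitFun_vadd f t s x]
    exact (hx.2 f).translate hB (isBddMeas_orbitFun f x) t

/-- The Fourier-Bohr coefficients at a point of `Bap` are represented by a vector of the
eigenspace. -/
theorem exists_eigenvector_of_mem_Bap (hB : IsOpenFolnerSeq μ B) (hx : x ∈ Bap μ B m)
    (ξ : DualChar G) : ∃ ψ ∈ eigenspace m ξ, ‖ψ‖ ≤ 1 ∧ ∀ f : C(X, ℂ),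
      ⟪ψ, ContinuousMap.toLp 2 m ℂ f⟫_ℂ = mean μ B (twistedOrbitFun f ξ x) := by
  have hm := fun f => hasMean_twistedOrbitFun hB hx f ξ
  let Λ : C(X, ℂ) →ₗ[ℂ] ℂ :=
    { toFun := fun f => mean μ B (twistedOrbitFun f ξ x)
      map_add' := fun f g => by
        refine HasMean.mean_eq ?_
        convert (hm f).add (hm g) (isBddMeas_twistedOrbitFun f ξ x)
          (isBddMeas_twistedOrbitFun g ξ x) using 1
        funext t
        simp [twistedOrbitFun, orbitFun, add_mul]
      map_smul' := fun c f => by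
        refine HasMean.mean_eq ?_
        rw [RingHom.id_apply, smul_eq_mul]
        convert (hm f).const_mul c using 1
        funext t
        simp [twistedOrbitFun, orbitFun, mul_assoc] }
  -- Bessel's inequality for the single frequency ξ. It extends Λ to L², where the Riesz theorem
  -- provides ψ.
  have hΛ : ∀ f, ‖Λ f‖ ≤ 1 * ‖(ContinuousMap.toLp 2 m ℂ (E := ℂ)).toLinearMap f‖ := fun f => by
    have h := sum_normSq_mean_le hB hx f {ξ}
    rw [Finset.sum_singleton] at h
    rw [one_mul]
    exact (pow_le_pow_iff_left₀ (norm_nonneg _) (norm_nonneg _) two_ne_zero).1 h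
  have hd : DenseRange (ContinuousMap.toLp 2 m ℂ (E := ℂ)).toLinearMap := denseRange_toLp
  let L : Lp ℂ 2 m →L[ℂ] ℂ := Λ.extendOfNorm (ContinuousMap.toLp 2 m ℂ (E := ℂ)).toLinearMap
  let ψ := (InnerProductSpace.toDual ℂ (Lp ℂ 2 m)).symm L
  have hψ : ∀ f : C(X, ℂ),
      ⟪ψ, ContinuousMap.toLp 2 m ℂ f⟫_ℂ = mean μ B (twistedOrbitFun f ξ x) := fun f => by
    rw [InnerProductSpace.toDual_symm_apply]
    exact LinearMap.extendOfNorm_eq hd ⟨1, hΛ⟩ f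
  refine ⟨ψ, mem_eigenspace_of_inner_koopman fun t f => ?_, ?_, hψ⟩
  · rw [koopman_toLp, hψ, hψ]
    refine HasMean.mean_eq (hasMean_twisted_of_translate hB (hm f) t fun s => ?_)
    rw [twistedOrbitFun, orbitFun_translateFun]
  · rw [LinearIsometryEquiv.norm_map]
    exact LinearMap.opNorm_extendOfNorm_le hd zero_le_one hΛ

/-- Only orthogonality is available here; the factor 2 - ‖ψ ξ‖² accounts for vectors not yet known
to be normalized. -/
theorem norm_sub_sum_sq {ψ : DualChar G → Lp ℂ 2 m} (hψ : ∀ ξ, ψ ξ ∈ eigenspace m ξ)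
    (φ : Lp ℂ 2 m) (F : Finset (DualChar G)) :
    ‖φ - ∑ ξ ∈ F, ⟪ψ ξ, φ⟫_ℂ • ψ ξ‖ ^ 2 =
      ‖φ‖ ^ 2 - ∑ ξ ∈ F, ‖⟪ψ ξ, φ⟫_ℂ‖ ^ 2 * (2 - ‖ψ ξ‖ ^ 2) := by
  classical
  have e2 : ∀ z : ℂ, z * (starRingEnd ℂ) z = ((‖z‖ ^ 2 : ℝ) : ℂ) := fun z => by
    rw [Complex.mul_conj, Complex.normSq_eq_norm_sq]
  have h1 : ⟪φ, ∑ ξ ∈ F, ⟪ψ ξ, φ⟫_ℂ • ψ ξ⟫_ℂ = ((∑ ξ ∈ F, ‖⟪ψ ξ, φ⟫_ℂ‖ ^ 2 : ℝ) : ℂ) := by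
    rw [inner_sum, Complex.ofReal_sum]
    refine Finset.sum_congr rfl fun ξ _ => ?_
    rw [inner_smul_right, ← e2, inner_conj_symm]
  have h2 : ∀ ξ ∈ F, ⟪ψ ξ, ∑ η ∈ F, ⟪ψ η, φ⟫_ℂ • ψ η⟫_ℂ = ⟪ψ ξ, φ⟫_ℂ * ((‖ψ ξ‖ ^ 2 : ℝ) : ℂ) := by
    intro ξ hξ
    rw [inner_sum, Finset.sum_eq_single ξ, inner_smul_right, inner_self_eq_norm_sq_to_K]
    · push_cast; rfl
    · intro η _ hne
      rw [inner_smul_right, inner_eq_zero_of_mem_eigenspace hne.symm (hψ ξ) (hψ η), mul_zero]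
    · exact fun h => absurd hξ h
  have h3 : ‖∑ ξ ∈ F, ⟪ψ ξ, φ⟫_ℂ • ψ ξ‖ ^ 2 = ∑ ξ ∈ F, ‖⟪ψ ξ, φ⟫_ℂ‖ ^ 2 * ‖ψ ξ‖ ^ 2 := by
    have h4 : ⟪∑ ξ ∈ F, ⟪ψ ξ, φ⟫_ℂ • ψ ξ, ∑ ξ ∈ F, ⟪ψ ξ, φ⟫_ℂ • ψ ξ⟫_ℂ =
        ((∑ ξ ∈ F, ‖⟪ψ ξ, φ⟫_ℂ‖ ^ 2 * ‖ψ ξ‖ ^ 2 : ℝ) : ℂ) := by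
      rw [sum_inner, Complex.ofReal_sum]
      refine Finset.sum_congr rfl fun ξ hξ => ?_
      rw [inner_smul_left, h2 ξ hξ, Complex.ofReal_mul, ← e2]
      ring
    rw [inner_self_eq_norm_sq_to_K] at h4
    rw [← Complex.ofReal_inj, ← h4]
    push_cast
    rfl
  rw [norm_sub_sq (𝕜 := ℂ), h1, h3]
  simp only [RCLike.re_to_complex, Complex.ofReal_re, mul_sub, Finset.sum_sub_distrib,
    ← Finset.sum_mul]
  ring

/-- At a point of `Bap` the vectors that represent the Fourier-Bohr coefficients are zero or
normalized, and they are total. -/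
theorem exists_eigenvectors_of_mem_Bap (hB : IsOpenFolnerSeq μ B) (hx : x ∈ Bap μ B m) :
    ∃ ψ : DualChar G → Lp ℂ 2 m, (∀ ξ, ψ ξ ∈ eigenspace m ξ) ∧ (∀ ξ, ψ ξ ≠ 0 → ‖ψ ξ‖ = 1) ∧
      (∀ ξ (f : C(X, ℂ)),
        ⟪ψ ξ, ContinuousMap.toLp 2 m ℂ f⟫_ℂ = mean μ B (twistedOrbitFun f ξ x)) ∧
      ∀ φ, (∀ ξ, ⟪ψ ξ, φ⟫_ℂ = 0) → φ = 0 := by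
  classical
  choose ψ hψ hψ1 hψm using exists_eigenvector_of_mem_Bap hB hx
  have hsq : ∀ ξ, ‖ψ ξ‖ ^ 2 ≤ 1 := fun ξ => pow_le_one₀ (norm_nonneg _) (hψ1 ξ)
  have hF : ∀ (f : C(X, ℂ)) (ε : ℝ), 0 < ε → ∃ F : Finset (DualChar G),
      ‖ContinuousMap.toLp 2 m ℂ f‖ ^ 2 -
        ∑ ξ ∈ F, ‖⟪ψ ξ, ContinuousMap.toLp 2 m ℂ f⟫_ℂ‖ ^ 2 ≤ ε := fun f ε hε => by
    simpa only [hψm] using exists_sum_normSq_mean_ge hB hx f hε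
  refine ⟨ψ, hψ, fun ξ h0 => ?_, hψm, fun φ hφ => ?_⟩
  · by_contra hne
    have hlt : 0 < 1 - ‖ψ ξ‖ ^ 2 :=
      sub_pos.2 (pow_lt_one₀ (norm_nonneg _) (lt_of_le_of_ne (hψ1 ξ) hne) two_ne_zero)
    apply h0
    have key : ∀ f : C(X, ℂ), ⟪ψ ξ, ContinuousMap.toLp 2 m ℂ f⟫_ℂ = 0 := by
      intro f
      set v := ContinuousMap.toLp 2 m ℂ f
      -- By `norm_sub_sum_sq` the terms |⟪ψ η, v⟫|² (2 - ‖ψ η‖²) add up to at most ‖v‖², while the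
      -- |⟪ψ η, v⟫|² alone already reach ‖v‖² - ε. The excess, a sum of nonnegative terms, is thus
      -- at most ε.
      have hle : ‖⟪ψ ξ, v⟫_ℂ‖ ^ 2 * (1 - ‖ψ ξ‖ ^ 2) ≤ 0 := by
        refine le_of_forall_pos_le_add fun ε hε => ?_
        obtain ⟨F, hFε⟩ := hF f ε hε
        have h1 := norm_sub_sum_sq hψ v (insert ξ F)
        have h2 : ∑ η ∈ F, ‖⟪ψ η, v⟫_ℂ‖ ^ 2 ≤ ∑ η ∈ insert ξ F, ‖⟪ψ η, v⟫_ℂ‖ ^ 2 :=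
          Finset.sum_le_sum_of_subset_of_nonneg (Finset.subset_insert _ _)
            fun _ _ _ => by positivity
        have h3 : ‖⟪ψ ξ, v⟫_ℂ‖ ^ 2 * (1 - ‖ψ ξ‖ ^ 2) ≤
            ∑ η ∈ insert ξ F, ‖⟪ψ η, v⟫_ℂ‖ ^ 2 * (1 - ‖ψ η‖ ^ 2) :=
          Finset.single_le_sum (f := fun η => ‖⟪ψ η, v⟫_ℂ‖ ^ 2 * (1 - ‖ψ η‖ ^ 2))
            (fun η _ => mul_nonneg (by positivity) (sub_nonneg.2 (hsq η)))
            (Finset.mem_insert_self _ _)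
        have h4 : ∑ η ∈ insert ξ F, ‖⟪ψ η, v⟫_ℂ‖ ^ 2 * (2 - ‖ψ η‖ ^ 2) =
            ∑ η ∈ insert ξ F, ‖⟪ψ η, v⟫_ℂ‖ ^ 2 * (1 - ‖ψ η‖ ^ 2) +
            ∑ η ∈ insert ξ F, ‖⟪ψ η, v⟫_ℂ‖ ^ 2 := by
          rw [← Finset.sum_add_distrib]
          exact Finset.sum_congr rfl fun η _ => by ring
        have h5 := sq_nonneg ‖v - ∑ η ∈ insert ξ F, ⟪ψ η, v⟫_ℂ • ψ η‖
        linarith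
      have h6 : ‖⟪ψ ξ, v⟫_ℂ‖ ^ 2 = 0 :=
        le_antisymm (nonpos_of_mul_nonpos_left hle hlt) (by positivity)
      simpa using h6
    have h7 := denseRange_toLp.induction_on (ψ ξ) (p := fun φ => ⟪ψ ξ, φ⟫_ℂ = 0)
      (isClosed_eq (continuous_const.inner continuous_id) continuous_const) key
    exact inner_self_eq_zero.1 h7
  · have key : ∀ f : C(X, ℂ), ⟪φ, ContinuousMap.toLp 2 m ℂ f⟫_ℂ = 0 := by
      intro f
      set v := ContinuousMap.toLp 2 m ℂ f
      have hle : ‖⟪φ, v⟫_ℂ‖ ≤ 0 := by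
        refine le_of_forall_pos_le_add fun ε hε => ?_
        set δ := ε / (‖φ‖ + 1)
        have hδ : 0 < δ := by positivity
        obtain ⟨F, hFε⟩ := hF f (δ ^ 2) (by positivity)
        have h1 := norm_sub_sum_sq hψ v F
        have h2 : ∑ ξ ∈ F, ‖⟪ψ ξ, v⟫_ℂ‖ ^ 2 ≤ ∑ ξ ∈ F, ‖⟪ψ ξ, v⟫_ℂ‖ ^ 2 * (2 - ‖ψ ξ‖ ^ 2) :=
          Finset.sum_le_sum fun ξ _ => le_mul_of_one_le_right (by positivity)
            (by linarith [hsq ξ])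
        have h3 : ‖v - ∑ ξ ∈ F, ⟪ψ ξ, v⟫_ℂ • ψ ξ‖ ≤ δ :=
          (pow_le_pow_iff_left₀ (norm_nonneg _) hδ.le two_ne_zero).1 (by linarith)
        -- φ is orthogonal to every ψ ξ, so v may be replaced by its remainder, of norm at most δ.
        have h4 : ⟪φ, v⟫_ℂ = ⟪φ, v - ∑ ξ ∈ F, ⟪ψ ξ, v⟫_ℂ • ψ ξ⟫_ℂ := by
          rw [inner_sub_right, inner_sum, Finset.sum_eq_zero, sub_zero]
          intro ξ _
          rw [inner_smul_right, ← inner_conj_symm φ (ψ ξ), hφ ξ, map_zero, mul_zero]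
        rw [h4, zero_add]
        calc _ ≤ ‖φ‖ * δ := (norm_inner_le_norm _ _).trans
              (mul_le_mul_of_nonneg_left h3 (norm_nonneg _))
          _ ≤ (‖φ‖ + 1) * δ := by gcongr; linarith
          _ = ε := by simp only [δ]; field_simp
      exact norm_le_zero_iff.1 hle
    have h7 := denseRange_toLp.induction_on φ (p := fun χ => ⟪φ, χ⟫_ℂ = 0)
      (isClosed_eq (continuous_const.inner continuous_id) continuous_const) key
    exact inner_self_eq_zero.1 h7

theorem hasPurePointSpectrum_of_mem_Bap (hB : IsOpenFolnerSeq μ B) (hx : x ∈ Bap μ B m) :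
    HasPurePointSpectrum G m := by
  obtain ⟨ψ, hψ, hnorm, -, htot⟩ := exists_eigenvectors_of_mem_Bap hB hx
  -- Different members of S come from different characters and are therefore orthogonal.
  let S : Set (Lp ℂ 2 m) := {φ | φ ≠ 0 ∧ ∃ ξ, φ = ψ ξ}
  have hon : Orthonormal ℂ (fun φ : S => (φ : Lp ℂ 2 m)) := by
    refine ⟨?_, ?_⟩
    · rintro ⟨_, h0, ξ, rfl⟩
      exact hnorm ξ h0
    · rintro ⟨_, h0, ξ, rfl⟩ ⟨_, h1, η, rfl⟩ hne
      refine inner_eq_zero_of_mem_eigenspace (fun h => hne ?_) (hψ ξ) (hψ η)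
      subst h
      rfl
  have hsp : (Submodule.span ℂ (Set.range fun φ : S => (φ : Lp ℂ 2 m)))ᗮ = ⊥ := by
    rw [Submodule.eq_bot_iff]
    intro φ hφ
    refine htot φ fun ξ => ?_
    by_cases h0 : ψ ξ = 0
    · rw [h0, inner_zero_left]
    · exact (Submodule.mem_orthogonal _ _).1 hφ _ (Submodule.subset_span ⟨⟨ψ ξ, h0, ξ, rfl⟩, rfl⟩)
  refine ⟨S, HilbertBasis.mkOfOrthogonalEqBot hon hsp, HilbertBasis.coe_mkOfOrthogonalEqBot _ _, ?_⟩
  rintro _ ⟨h0, ξ, rfl⟩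
  exact ⟨h0, fun t => ⟨_, (mem_eigenspace_iff m ξ _).1 (hψ ξ) t⟩⟩

/-- An eigenvector of ξ is orthogonal to ψ η for η ≠ ξ. If ξ is not a frequency, then ψ ξ is
orthogonal to everything as well, and totality makes the eigenvector zero. -/
theorem Eig_eq_Freq_of_mem_Bap (hB : IsOpenFolnerSeq μ B) (hx : x ∈ Bap μ B m) :
    (Eig m : Set (DualChar G)) = Freq μ B x := by
  obtain ⟨ψ, hψ, hnorm, hm, htot⟩ := exists_eigenvectors_of_mem_Bap hB hx
  ext ξ
  constructor
  · rintro ⟨φ, h0, hφ⟩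
    have hφ' := (mem_eigenspace_iff m ξ φ).2 hφ
    by_contra hc
    apply h0
    refine htot φ fun η => ?_
    by_cases hne : η = ξ
    · subst hne
      have key : ∀ f : C(X, ℂ), ⟪ψ η, ContinuousMap.toLp 2 m ℂ f⟫_ℂ = 0 := fun f => by
        by_contra hne
        exact hc ⟨f, _, hasMean_twistedOrbitFun hB hx f η, by rwa [hm] at hne⟩
      exact denseRange_toLp.induction_on φ (p := fun χ => ⟪ψ η, χ⟫_ℂ = 0)
        (isClosed_eq (continuous_const.inner continuous_id) continuous_const) key
    · exact inner_eq_zero_of_mem_eigenspace hne (hψ η) hφ'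
  · rintro ⟨f, a, ha, h0⟩
    refine ⟨ψ ξ, fun h => h0 ?_, (mem_eigenspace_iff m ξ _).1 (hψ ξ)⟩
    rw [← ha.mean_eq, ← hm, h, inner_zero_left]

end BapPoints

/-! ### Pure point spectrum: almost every point lies in `Bap` -/

section AlmostEverywhere

variable {G X : Type*} [AddCommGroup G] [TopologicalSpace G] [IsTopologicalAddGroup G] [T2Space G]
  [LocallyCompactSpace G] [SigmaCompactSpace G] [MeasurableSpace G] [BorelSpace G]
  {μ : Measure G} [μ.IsAddHaarMeasure]
  [MetricSpace X] [CompactSpace X] [MeasurableSpace X] [BorelSpace X]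
  [AddAction G X] [ContinuousVAdd G X]
  {m : Measure X} [IsProbabilityMeasure m] [VAddInvariantMeasure G X m]
  {B : ℕ → Set G} {x : X}

theorem integral_norm_le_norm_Lp_two (h : Lp ℂ 2 m) : ∫ x, ‖h x‖ ∂m ≤ ‖h‖ := by
  have hm : AEStronglyMeasurable h m := (Lp.memLp h).1
  rw [integral_norm_eq_lintegral_enorm hm, ← eLpNorm_one_eq_lintegral_enorm, Lp.norm_def]
  exact ENNReal.toReal_mono (Lp.memLp h).2.ne
    (eLpNorm_le_eLpNorm_of_exponent_le (by norm_num) hm)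

/-- Along almost every orbit a linear combination of eigenfunctions is a trigonometric
polynomial. -/
theorem ae_orbit_eq_trigPoly {g : Lp ℂ 2 m}
    (hg : g ∈ Submodule.span ℂ {φ : Lp ℂ 2 m | ∃ ξ : DualChar G, φ ∈ eigenspace m ξ}) :
    ∀ᵐ x ∂m, ∃ Q ∈ trigPoly G, ∀ᵐ t ∂μ, g (t +ᵥ x) = Q t := by
  induction hg using Submodule.span_induction with
  | mem φ hφ =>
    obtain ⟨ξ, hξ⟩ := hφ
    filter_upwards [ae_orbit_eigenspace (μ := μ) hξ] with x hx
    refine ⟨_, (trigPoly G).smul_mem (φ x) (dualChar_mem_trigPoly ξ), ?_⟩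
    filter_upwards [hx] with t ht
    rw [ht, mul_comm]
    rfl
  | zero =>
    filter_upwards [ae_orbit (μ := μ) (Lp.coeFn_zero ℂ 2 m)] with x hx
    exact ⟨0, (trigPoly G).zero_mem, hx⟩
  | add φ ψ _ _ hφ hψ =>
    filter_upwards [hφ, hψ, ae_orbit (μ := μ) (Lp.coeFn_add φ ψ)] with x ⟨P, hP, h1⟩ ⟨Q, hQ, h2⟩ hx
    refine ⟨P + Q, (trigPoly G).add_mem hP hQ, ?_⟩
    filter_upwards [h1, h2, hx] with t h3 h4 h5
    rw [h5, Pi.add_apply, h3, h4]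
    rfl
  | smul c φ _ hφ =>
    filter_upwards [hφ, ae_orbit (μ := μ) (Lp.coeFn_smul c φ)] with x ⟨P, hP, h1⟩ hx
    refine ⟨c • P, (trigPoly G).smul_mem c hP, ?_⟩
    filter_upwards [h1, hx] with t h3 h5
    rw [h5, Pi.smul_apply, h3]
    rfl

theorem HasPurePointSpectrum.exists_approx (h : HasPurePointSpectrum G m) (φ : Lp ℂ 2 m) {ε : ℝ}
    (hε : 0 < ε) : ∃ g ∈ Submodule.span ℂ {φ : Lp ℂ 2 m | ∃ ξ : DualChar G, φ ∈ eigenspace m ξ},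
      ‖φ - g‖ < ε := by
  obtain ⟨S, b, hb, hS⟩ := h
  have h1 : φ ∈ (Submodule.span ℂ (Set.range b)).topologicalClosure := by
    rw [b.dense_span]; trivial
  obtain ⟨g, hg, hd⟩ := Metric.mem_closure_iff.1 h1 ε hε
  refine ⟨g, Submodule.span_mono ?_ hg, by rwa [← dist_eq_norm]⟩
  rintro _ ⟨s, rfl⟩
  rw [hb]
  exact (hS s s.2).exists_mem_eigenspace

/-- Birkhoff's theorem turns the mean error along the orbit into ∫ |f - g|, which is at most ‖f - g‖
< ε because m is a probability measure. -/
theorem ae_exists_trigPoly_approx (hBirkhoff : BirkhoffHolds μ B m)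
    (hpp : HasPurePointSpectrum G m) (f : C(X, ℂ)) {ε : ℝ} (hε : 0 < ε) :
    ∀ᵐ x ∂m, ∃ Q ∈ trigPoly G, ∀ᶠ n in atTop, ⨍ s in B n, ‖orbitFun f x s - Q s‖ ∂μ ≤ ε := by
  obtain ⟨g, hg, hlt⟩ := hpp.exists_approx (ContinuousMap.toLp 2 m ℂ f) hε
  set h : Lp ℂ 2 m := ContinuousMap.toLp 2 m ℂ f - g
  have hint : Integrable h m := (Lp.memLp h).integrable (by norm_num)
  have hI : ‖∫ y, ((‖h y‖ : ℝ) : ℂ) ∂m‖ < ε := by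
    rw [integral_complex_ofReal, Complex.norm_real,
      Real.norm_of_nonneg (integral_nonneg fun _ => norm_nonneg _)]
    exact (integral_norm_le_norm_Lp_two h).trans_lt hlt
  have hh : ∀ᵐ y ∂m, h y = f y - g y := by
    filter_upwards [Lp.coeFn_sub (ContinuousMap.toLp 2 m ℂ f) g,
      ContinuousMap.coeFn_toLp (p := 2) m (𝕜 := ℂ) f] with y h1 h2
    rw [h1, Pi.sub_apply, h2]
  filter_upwards [hBirkhoff (fun y => ((‖h y‖ : ℝ) : ℂ)) hint.norm.ofReal,
    ae_orbit_eq_trigPoly (μ := μ) hg, ae_orbit (μ := μ) hh] with x h1 ⟨Q, hQ, h2⟩ h3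
  refine ⟨Q, hQ, ?_⟩
  filter_upwards [h1.norm.eventually (gt_mem_nhds hI)] with n hn
  have h4 : ⨍ s in B n, orbitFun (fun y => ((‖h y‖ : ℝ) : ℂ)) x s ∂μ =
      ((⨍ s in B n, ‖orbitFun f x s - Q s‖ ∂μ : ℝ) : ℂ) := by
    refine Eq.trans ?_ integral_ofReal
    refine integral_congr_ae (ae_avgMeasure ?_ n)
    filter_upwards [h2, h3] with t h5 h6
    simp [orbitFun, h5, h6]
  rw [h4, Complex.norm_real] at hn
  exact (le_abs_self _).trans hn.le

theorem setAverage_norm_sub_le (hB : IsOpenFolnerSeq μ B) {h g k : G → ℂ} (hh : IsBddMeas h)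
    (hg : IsBddMeas g) (hk : IsBddMeas k) {δ : ℝ} (hδ : ∀ t, ‖h t - g t‖ ≤ δ) (n : ℕ) :
    ⨍ s in B n, ‖h s - k s‖ ∂μ ≤ δ + ⨍ s in B n, ‖g s - k s‖ ∂μ := by
  calc _ ≤ ⨍ s in B n, (‖h s - g s‖ + ‖g s - k s‖) ∂μ :=
        setAverage_mono (hh.sub hk).norm ((hh.sub hg).norm.add (hg.sub hk).norm)
          (fun t => norm_sub_le_norm_sub_add_norm_sub _ _ _) n
    _ = ⨍ s in B n, ‖h s - g s‖ ∂μ + ⨍ s in B n, ‖g s - k s‖ ∂μ :=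
        setAverage_add (hh.sub hg).norm (hg.sub hk).norm n
    _ ≤ _ := by
        gcongr
        exact setAverage_le_const hB (hh.sub hg).norm hδ n

/-- Membership in `Bap` can be tested on a dense set of continuous functions. -/
theorem mem_Bap_of_dense (hB : IsOpenFolnerSeq μ B) {D : Set C(X, ℂ)} (hD : Dense D)
    (hap : ∀ f ∈ D, ∀ k : ℕ, ∃ Q ∈ trigPoly G,
      ∀ᶠ n in atTop, ⨍ s in B n, ‖orbitFun f x s - Q s‖ ∂μ ≤ 1 / (k + 1 : ℝ))
    (hgen : ∀ f ∈ D, HasMean μ B (orbitFun f x) (∫ y, f y ∂m)) : x ∈ Bap μ B m := by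
  have happrox : ∀ (f : C(X, ℂ)) (ε : ℝ), 0 < ε → ∃ g ∈ D, ∀ y, ‖f y - g y‖ ≤ ε := by
    intro f ε hε
    obtain ⟨g, hg, hd⟩ := Metric.dense_iff.1 hD f ε hε
    refine ⟨g, hd, fun y => ?_⟩
    have h1 := (f - g).norm_coe_le_norm y
    rw [Metric.mem_ball, dist_comm, dist_eq_norm] at hg
    exact h1.trans hg.le
  refine ⟨fun f => (isBesicovitchAPFun_iff hB).2 ⟨isBddMeas_orbitFun f x, fun ε hε => ?_⟩,
    fun f => hasMean_of_approx hB (isBddMeas_orbitFun f x) fun ε hε => ?_⟩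
  · obtain ⟨g, hg, hfg⟩ := happrox f (ε / 2) (by positivity)
    obtain ⟨k, hk⟩ := exists_nat_one_div_lt (half_pos hε)
    obtain ⟨Q, hQ, hev⟩ := hap g hg k
    refine ⟨Q, hQ, ?_⟩
    filter_upwards [hev] with n hn
    have := setAverage_norm_sub_le (μ := μ) hB (isBddMeas_orbitFun f x) (isBddMeas_orbitFun g x)
      (isBddMeas_of_mem_trigPoly hQ) (fun t => hfg (t +ᵥ x)) n
    linarith
  · obtain ⟨g, hg, hfg⟩ := happrox f ε hε
    refine ⟨_, _, isBddMeas_orbitFun g x, hgen g hg, ?_, Eventually.of_forall fun n =>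
      setAverage_le_const hB ((isBddMeas_orbitFun f x).sub (isBddMeas_orbitFun g x)).norm
        (fun t => hfg (t +ᵥ x)) n⟩
    have hi : ∀ f : C(X, ℂ), Integrable f m := fun f =>
      f.continuous.integrable_of_hasCompactSupport (HasCompactSupport.of_compactSpace f)
    rw [← integral_sub (hi f) (hi g)]
    refine (norm_integral_le_of_norm_le_const (ae_of_all _ hfg)).trans_eq ?_
    simp

/-- The exceptional null sets depend on f and on the tolerance; a countable dense set of f and the
tolerances 1 / (k + 1) leave only countably many. -/
theorem HasPurePointSpectrum.ae_mem_Bap (hB : IsOpenFolnerSeq μ B)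
    (hBirkhoff : BirkhoffHolds μ B m) (hpp : HasPurePointSpectrum G m) :
    ∀ᵐ x ∂m, x ∈ Bap μ B m := by
  obtain ⟨D, hDc, hDd⟩ := TopologicalSpace.exists_countable_dense C(X, ℂ)
  have h1 : ∀ᵐ x ∂m, ∀ f ∈ D, ∀ k : ℕ, ∃ Q ∈ trigPoly G,
      ∀ᶠ n in atTop, ⨍ s in B n, ‖orbitFun f x s - Q s‖ ∂μ ≤ 1 / (k + 1 : ℝ) := by
    rw [ae_ball_iff hDc]
    intro f _
    rw [ae_all_iff]
    exact fun k => ae_exists_trigPoly_approx hBirkhoff hpp f (by positivity)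
  have h2 : ∀ᵐ x ∂m, ∀ f ∈ D, HasMean μ B (orbitFun f x) (∫ y, f y ∂m) := by
    rw [ae_ball_iff hDc]
    exact fun f _ => hBirkhoff f
      (f.continuous.integrable_of_hasCompactSupport (HasCompactSupport.of_compactSpace f))
  filter_upwards [h1, h2] with x h3 h4 using mem_Bap_of_dense hB hDd h3 h4

/-! ### The functions `e_{f,ξ}` -/

theorem eFun_of_mem (hx : x ∈ Bap μ B m) (f : C(X, ℂ)) (ξ : DualChar G) :
    eFun μ B m f ξ x = mean μ B (twistedOrbitFun f ξ x) :=
  Set.indicator_of_mem hx _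

theorem eFun_vadd (hB : IsOpenFolnerSeq μ B) (f : C(X, ℂ)) (ξ : DualChar G) (t : G) (x : X) :
    eFun μ B m f ξ (t +ᵥ x) = (ξ.1 t : ℂ) * eFun μ B m f ξ x := by
  by_cases hx : x ∈ Bap μ B m
  · rw [eFun_of_mem hx, eFun_of_mem (vadd_mem_Bap hB hx t)]
    refine HasMean.mean_eq (hasMean_twisted_of_translate hB (hasMean_twistedOrbitFun hB hx f ξ) t
      fun s => ?_)
    rw [twistedOrbitFun, orbitFun_vadd]
  · have hx2 : t +ᵥ x ∉ Bap μ B m := fun h => hx (by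
      have := vadd_mem_Bap hB h (-t)
      rwa [neg_vadd_vadd] at this)
    rw [eFun, Set.indicator_of_notMem hx, Set.indicator_of_notMem hx2, mul_zero]

theorem inner_eigenProj {ξ : DualChar G} {ψ : Lp ℂ 2 m} (hψ : ψ ∈ eigenspace m ξ)
    (φ : Lp ℂ 2 m) : ⟪ψ, eigenProj m ξ φ⟫_ℂ = ⟪ψ, φ⟫_ℂ := by
  rw [eigenProj, ← Submodule.inner_starProjection_left_eq_right,
    Submodule.starProjection_eq_self_iff.2 hψ]

theorem eigenProj_mem (ξ : DualChar G) (φ : Lp ℂ 2 m) : eigenProj m ξ φ ∈ eigenspace m ξ :=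
  Submodule.starProjection_apply_mem _ _

/-- The coefficient is ⟪ψ ξ, P_ξ f⟫, whose modulus is ‖ψ ξ‖ ‖P_ξ f‖. Either ψ ξ is a unit vector, or
it is zero and totality gives P_ξ f = 0; the point x drops out in both cases. -/
theorem norm_eFun_of_mem_Bap (hB : IsOpenFolnerSeq μ B) (hBirkhoff : BirkhoffHolds μ B m)
    (hx : x ∈ Bap μ B m) (f : C(X, ℂ)) (ξ : DualChar G) :
    ‖eFun μ B m f ξ x‖ = ‖eigenProj m ξ (ContinuousMap.toLp 2 m ℂ f)‖ := by
  obtain ⟨ψ, hψ, hnorm, hm, htot⟩ := exists_eigenvectors_of_mem_Bap hB hx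
  have hp := eigenProj_mem ξ (ContinuousMap.toLp 2 m ℂ f)
  rw [eFun_of_mem hx, ← hm, ← inner_eigenProj (hψ ξ),
    norm_inner_eq_of_mem_eigenspace hB hBirkhoff (hψ ξ) hp]
  by_cases h0 : ψ ξ = 0
  · rw [htot (eigenProj m ξ (ContinuousMap.toLp 2 m ℂ f)) fun η => ?_, norm_zero, mul_zero]
    by_cases hne : η = ξ
    · rw [hne, h0, inner_zero_left]
    · exact inner_eq_zero_of_mem_eigenspace hne (hψ η) hp
  · rw [hnorm ξ h0, one_mul]

theorem eigenProj_ae_eq_eFun (hB : IsOpenFolnerSeq μ B) (hBirkhoff : BirkhoffHolds μ B m)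
    (hpp : HasPurePointSpectrum G m) (f : C(X, ℂ)) (ξ : DualChar G) :
    eigenProj m ξ (ContinuousMap.toLp 2 m ℂ f) =ᵐ[m] eFun μ B m f ξ := by
  set p := eigenProj m ξ (ContinuousMap.toLp 2 m ℂ f) with hpdef
  have hp : p ∈ eigenspace m ξ := eigenProj_mem ξ _
  have hbap := hpp.ae_mem_Bap (μ := μ) hB hBirkhoff
  by_cases h0 : p = 0
  -- Division by p is impossible here, but the modulus of e_{f,ξ} on `Bap` is ‖p‖ = 0.
  · filter_upwards [hbap, Lp.coeFn_zero ℂ 2 m] with x hx h1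
    have h2 := norm_eFun_of_mem_Bap hB hBirkhoff hx f ξ
    rw [← hpdef, h0, norm_zero, norm_eq_zero] at h2
    rw [h0, h1, h2]
    rfl
  · have hf := ContinuousMap.coeFn_toLp (p := 2) m (𝕜 := ℂ) f
    filter_upwards [hbap, ae_mul_conj_eq_inner hB hBirkhoff hp hp,
      hBirkhoff _ (integrable_mul_conj p (ContinuousMap.toLp 2 m ℂ f)),
      ae_orbit_eigenspace (μ := μ) hp, ae_orbit (μ := μ) hf] with x hx h1 h2 h3 h4
    have h5 : ∫ y, ContinuousMap.toLp 2 m ℂ f y * (starRingEnd ℂ) (p y) ∂m = ⟪p, p⟫_ℂ := by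
      rw [hpdef, inner_eigenProj (eigenProj_mem ξ _), L2.inner_def]
      rfl
    have h6 := (hasMean_twistedOrbitFun hB hx f ξ).const_mul ((starRingEnd ℂ) (p x))
    -- The orbit mean of f conj p is computed twice: by p(t x) = ξ(t) p(x) it is conj (p x)
    -- e_{f,ξ}(x), by Birkhoff's theorem it is ⟪p, f⟫ = ⟪p, p⟫. Since |p x|² = ⟪p, p⟫ too, conj (p
    -- x) cancels.
    have h7 : (starRingEnd ℂ) (p x) * mean μ B (twistedOrbitFun f ξ x) = ⟪p, p⟫_ℂ := by
      refine HasMean.unique (h6.congr_ae ?_) (h5 ▸ h2)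
      filter_upwards [h3, h4] with t h8 h9
      rw [twistedOrbitFun, orbitFun, orbitFun, h8, h9, map_mul]
      ring
    rw [eFun_of_mem hx]
    have hne : (starRingEnd ℂ) (p x) ≠ 0 := fun hc => h0 (by
      rw [hc, mul_zero] at h1
      exact inner_self_eq_zero.1 h1.symm)
    exact mul_left_cancel₀ hne (by rw [h7, mul_comm, h1])

end AlmostEverywhere

/-! ### The theorem -/

theorem mainTheorem4
    {G X : Type*}
    [AddCommGroup G] [TopologicalSpace G] [IsTopologicalAddGroup G] [T2Space G]
    [LocallyCompactSpace G] [SigmaCompactSpace G] [MeasurableSpace G] [BorelSpace G]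
    (μ : Measure G) [μ.IsAddHaarMeasure]
    [MetricSpace X] [CompactSpace X] [MeasurableSpace X] [BorelSpace X]
    [AddAction G X] [ContinuousVAdd G X]
    (m : Measure X) [IsProbabilityMeasure m] [VAddInvariantMeasure G X m]
    (B : ℕ → Set G) (hB : IsOpenFolnerSeq μ B)
    (hm : IsErgodicSystem G m) (hBirkhoff : BirkhoffHolds μ B m) :
    [HasPurePointSpectrum G m,
      NullMeasurableSet (Bap μ B m) m ∧ m (Bap μ B m) = 1,
      (Bap μ B m).Nonempty].TFAE ∧
    (HasPurePointSpectrum G m →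
      (∀ x ∈ Bap μ B m, (Eig m : Set (DualChar G)) = Freq μ B x) ∧
      ∀ (f : C(X, ℂ)) (ξ : DualChar G),
        (∀ x ∈ Bap μ B m, HasMean μ B (twistedOrbitFun f ξ x) (eFun μ B m f ξ x)) ∧
        (eigenProj m ξ (ContinuousMap.toLp 2 m ℂ f) =ᵐ[m] eFun μ B m f ξ) ∧
        (∀ (t : G) (x : X), eFun μ B m f ξ (t +ᵥ x) = (ξ.1 t : ℂ) * eFun μ B m f ξ x) ∧
        ∃ r : ℝ, ∀ x ∈ Bap μ B m, ‖eFun μ B m f ξ x‖ = r) := by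
  refine ⟨?_, fun hpp => ⟨fun x hx => Eig_eq_Freq_of_mem_Bap hB hx, fun f ξ =>
    ⟨fun x hx => ?_, eigenProj_ae_eq_eFun hB hBirkhoff hpp f ξ, eFun_vadd hB f ξ,
      _, fun x hx => norm_eFun_of_mem_Bap hB hBirkhoff hx f ξ⟩⟩⟩
  · tfae_have 1 → 2 := fun hpp => by
      have h := hpp.ae_mem_Bap hB hBirkhoff
      -- Null measurability comes from agreement with the whole space almost everywhere, without any
      -- description of `Bap`.
      have h2 : Bap μ B m =ᵐ[m] Set.univ := eventuallyEq_univ.2 h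
      exact ⟨MeasurableSet.univ.nullMeasurableSet.congr h2.symm,
        (measure_congr h2).trans measure_univ⟩
    tfae_have 2 → 3 := fun h => nonempty_of_measure_ne_zero (by rw [h.2]; exact one_ne_zero)
    tfae_have 3 → 1 := fun ⟨x, hx⟩ => hasPurePointSpectrum_of_mem_Bap hB hx
    tfae_finish
  · rw [eFun_of_mem hx]
    exact hasMean_twistedOrbitFun hB hx f ξ
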